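/- **Setting.** Let $d\in\{2,3\}$, let $\Omega\subset\mathbb R^d$ be a bounded polyhedral domain, and let $\Gamma_d\subset\partial\Omega$ be measurable with $0<|\Gamma_d|$ and $|\partial\Omega\setminus\Gamma_d|>0$ (surface measure). Write $\langle\cdot,\cdot\rangle$ for the $L^2(\Omega)$ inner product, $\|\cdot\|_m$ for the $H^m(\Omega)$ norm, $\varepsilon(\cdot)$ for the symmetric gradient, and set $V=H^1_{0,\Gamma_d}(\Omega;\mathbb R^d)$. Let $N$ be the number of networks. Let $\mu>0$, $\lambda>0$ with $\mu\le c_\lambda\lambda$, $0<s_i\le s_{\max}$, $\alpha_i\in(0,1]$; let $K_i(x)$ be measurable symmetric matrices with $K_i^-|z|^2\le z\cdot K_i(x)z\le K_i^+|z|^2$ for a.e. $x$ and all $z\in\mathbb R^d$, where $0<K_i^-\le K_i^+$; and let $\xi_{j\leftarrow i}=\xi_{i\leftarrow j}\ge 0$ be bounded measurable functions. Put $\alpha\cdot p=\sum_i\alpha_ip_i$ and $\xi_i(p)=\sum_{j}\xi_{j\leftarrow i}(p_i-p_j)$. **Exact solution.** Let $f\in C^0([0,T];L^2(\Omega;\mathbb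 R^d))$, $g_i\in C^0([0,T];L^2(\Omega))$. Let $u\in C^0([0,T];V)$, $p_t\in C^0([0,T];L^2(\Omega))\cap C^1((0,T];L^2(\Omega))$, $p_i\in C^0([0,T];H^1_0(\Omega))\cap C^1((0,T];H^1_0(\Omega))$ satisfy, for $t\in(0,T]$, $$\langle2\mu\varepsilon(u),\varepsilon(v)\rangle-\langle p_t,\operatorname{div}v\rangle=\langle f,v\rangle\quad\forall v\in V,$$ $$-\langle\operatorname{div}u,q\rangle-\langle\lambda^{-1}p_t,q\rangle+\langle\lambda^{-1}\alpha\cdot p,q\rangle=0\quad\forall q\in L^2(\Omega),$$ $$\langle s_i\dot p_i+\alpha_i\lambda^{-1}(-\dot p_t+\alpha\cdot\dot p)+\xi_i(p),q\rangle+\langle K_i\nabla p_i,\nabla q\rangle=\langle g_i,q\rangle\quad\forall q\in H^1_0(\Omega),\ 1\le i\le N,$$ with initial values $(u^0,p_t^0,p^0)\in V\times L^2(\Omega)\times H^1_0(\Omega)^N$ that are compatible, i.e. satisfy the first two equations at $t=0$. Assume that the solution is sufficiently regular: for integers $k_u,k_p\ge1$, the norms of $u$ in $L^\infty(0,T;H^{k_u+1})$,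 of $p_t$ in $L^\infty(0,T;H^{k_u})$, of $p_i$ in $L^\infty(0,T;H^{k_p+1})$ (suprema over all $t\in[0,T]$), and of the $C^3$ functions $p_t,p_i:[0,T]\to L^2(\Omega)$ in $W^{3,\infty}(0,T;L^2)$ are at most $M$. **Discretization.** Let $h>0$, $0<\Delta t\le T$, and let $V_h\subset V$, $Q_{t,h}\subset L^2(\Omega)$, $Q_{i,h}\subset L^2(\Omega)$ be finite dimensional. Put $\|v\|_V^2=\langle2\mu\varepsilon(v),\varepsilon(v)\rangle$, $\|q\|_{Q_t}^2=\langle(2\mu)^{-1}q,q\rangle$. Assume the inf-sup condition $\sup_{v\in V_h}\langle\operatorname{div}v,q\rangle/\|v\|_V\ge\beta\|q\|_{Q_t}$ for $q\in Q_{t,h}$, with $\beta>0$, and the approximation properties $\inf_{v\in V_h}\|w-v\|_V\le c_{a}h^{k_u}\|w\|_{k_u+1}$ for $w\in V\cap H^{k_u+1}$ and $\inf_{q\in Q_{t,h}}\|r-q\|_{Q_t}\le c_{a}h^{k_u}\|r\|_{k_u}$ for $r\in H^{k_u}(\Omega)$. For each $i$, let $a_{h,i}$ be a symmetric bilinear form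 and $|||\cdot|||_i$ a seminorm on a subspace $W_i\subset L^2(\Omega)$ containing $Q_{i,h}$, such that * (consistency) if $w\in H_0^1\cap H^{k_p+1}$ and $-\operatorname{div}(K_i\nabla w)=F\in L^2(\Omega)$ weakly, then $w\in W_i$ and $a_{h,i}(w,q)=\langle F,q\rangle$ for all $q\in Q_{i,h}$; * (boundedness, coercivity, discrete Poincaré inequality) $|a_{h,i}(w,q)|\le c_s|||w|||_i\,|||q|||_i$, $|||q|||_i^2\le c_s\,a_{h,i}(q,q)$ and $\|w\|\le c_s|||w|||_i$ for $w\in W_i$, $q\in Q_{i,h}$; * (approximation) $\inf_{q\in Q_{i,h}}|||w-q|||_i\le c_ah^{k_p}\|w\|_{k_p+1}$ for $w\in H^1_0\cap H^{k_p+1}\cap W_i$. (For a conforming Galerkin method $a_{h,i}(p,q)=\langle K_i\nabla p,\nabla q\rangle$ on $W_i=H^1_0(\Omega)$ and $|||q|||_i^2=a_{h,i}(q,q)$.) Put $S(p,q)=\sum_i\langle s_ip_i,q_i\rangle+\langle\lambda^{-1}\alpha\cdot p,\alpha\cdot q\rangle$ and $A(p,q)=\sum_i\big(\langle\xi_i(p),q_i\rangle+a_{h,i}(p_i,q_i)\big)$,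 with $\|p\|_S^2=S(p,p)$, $\|p\|_A^2=A(p,p)$. Define projections: $(\Pi u,\Pi p_t)\in V_h\times Q_{t,h}$ satisfies $\langle2\mu\varepsilon(\Pi u-u),\varepsilon(v)\rangle-\langle\Pi p_t-p_t,\operatorname{div}v\rangle=0$ and $\langle\operatorname{div}(\Pi u-u),q\rangle+\langle\lambda^{-1}(\Pi p_t-p_t),q\rangle=0$ for all $v\in V_h$, $q\in Q_{t,h}$; and $\Pi p\in\prod_iQ_{i,h}$ satisfies $A(\Pi p,q)=A(p,q)$ for all $q\in\prod_iQ_{i,h}$. **Scheme.** Write $\sigma^n=\sigma(n\Delta t)$ and $\sigma^{1/2}=(\sigma^0+\sigma^1)/2$. Let $(u_h^0,p_{t,h}^0,p_h^0)\in V_h\times Q_{t,h}\times\prod_iQ_{i,h}$ satisfy $p_h^0=\Pi p^0$ and $\|u^0-u^0_h\|_V+\|p_t^0-p_{t,h}^0\|_{Q_t}\le c_0h^{k_u}(\|u^0\|_{k_u+1}+\|p_t^0\|_{k_u})$. Let $(u_h^1,p_{t,h}^1,p_h^1)$ in the same space satisfy, for all $v\in V_h$, $q\in Q_{t,h}$,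 $q_i\in Q_{i,h}$, $1\le i\le N$, $$\langle2\mu\varepsilon(u_h^1),\varepsilon(v)\rangle-\langle p_{t,h}^1,\operatorname{div}v\rangle=\langle f^1,v\rangle,$$ $$-\langle\operatorname{div}u_h^1,q\rangle-\langle\lambda^{-1}p_{t,h}^1,q\rangle+\langle\lambda^{-1}\alpha\cdot p_h^1,q\rangle=0,$$ $$-\Big\langle s_i\tfrac{p_{i,h}^1-p_{i,h}^0}{\Delta t},q_i\Big\rangle-\Big\langle-\alpha_i\lambda^{-1}\tfrac{p_{t,h}^1-p_{t,h}^0}{\Delta t}+\alpha_i\lambda^{-1}\alpha\cdot\tfrac{p_h^1-p_h^0}{\Delta t}+\xi_i(p_h^{1/2}),q_i\Big\rangle-a_{h,i}(p_{i,h}^{1/2},q_i)=-\langle g_i^{1/2},q_i\rangle .$$ For $\sigma\in\{u,p_t,p\}$ let $e_\sigma^{h,n}=\Pi\sigma^n-\sigma_h^n$ and $D_\sigma^0=e_\sigma^{h,1}-e_\sigma^{h,0}$. **Theorem.** There is a constant $C>0$, depending only on $d,N,\Omega,\Gamma_d,\mu,\alpha,K,\xi,T,k_u,k_p$, on the constants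 $s_{\max},c_\lambda,\beta,c_a,c_s,c_0$ and on the bound $M$ for the norms of the exact solution (and therefore independent of $h$, of $\Delta t$, of the discrete spaces and forms, and uniform in $s_i\in(0,s_{\max}]$ and in $\lambda\ge\mu/c_\lambda$), such that in every such situation $$\|D_u^0\|_V^2+\|D_{p_t}^0\|_{Q_t}^2+\|D_p^0\|_S^2+\Delta t\,\|e_p^{h,1}\|_A^2\le C\big((\Delta t)^6+h^{2k_p}+h^{2k_u}\big),$$ $$\|e_u^{h,1}\|_V+\|e_{p_t}^{h,1}\|_{Q_t}+\|e_p^{h,1}\|_S\le C\big((\Delta t)^3+h^{k_p}+h^{k_u}\big).$$ -/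

import Mathlib

open MeasureTheory Set Filter Topology
open scoped ENNReal ContDiff

noncomputable section

namespace MPET

/-! ### Lebesgue and Sobolev spaces -/

/-- Points of `ℝ^d` with the Euclidean norm. -/
abbrev Pt (d : ℕ) := EuclideanSpace ℝ (Fin d)

/-- The `j`-th coordinate vector. -/
def e {d : ℕ} (j : Fin d) : Pt d := EuclideanSpace.single j (1 : ℝ)

/-- `L²(Ω)`, real valued, with its Hilbert space structure. -/
abbrev L2 {d : ℕ} (Ω : Set (Pt d)) := Lp ℝ 2 (volume.restrict Ω)

/-- Test functions `C_c^∞(Ω)`. -/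
structure IsTest {d : ℕ} (Ω : Set (Pt d)) (φ : Pt d → ℝ) : Prop where
  smooth : ContDiff ℝ ∞ φ
  compact : HasCompactSupport φ
  supp : tsupport φ ⊆ Ω

/-- The classical mixed derivative `∂_{β 0} ⋯ ∂_{β (m-1)} φ`. -/
def mixedPartial {d m : ℕ} (β : Fin m → Fin d) (φ : Pt d → ℝ) (x : Pt d) : ℝ :=
  iteratedFDeriv ℝ m φ x (fun k => e (β k))

/-- `g` is the weak derivative `∂_{β 0} ⋯ ∂_{β (m-1)} u` on `Ω`. -/
def HasWeakPartial {d m : ℕ} {Ω : Set (Pt d)} (β : Fin m → Fin d) (u g : L2 Ω) : Prop :=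
  ∀ φ : Pt d → ℝ, IsTest Ω φ →
    ∫ x in Ω, u x * mixedPartial β φ x = (-1 : ℝ) ^ m * ∫ x in Ω, g x * φ x

/-- Membership in `H^m(Ω)`. -/
def MemHm {d : ℕ} {Ω : Set (Pt d)} (m : ℕ) (u : L2 Ω) : Prop :=
  ∀ j ≤ m, ∀ β : Fin j → Fin d, ∃ g : L2 Ω, HasWeakPartial β u g

open Classical in
/-- The weak derivative, if it exists in `L²(Ω)` (it is then unique). -/
def weakPartial {d m : ℕ} {Ω : Set (Pt d)} (β : Fin m → Fin d) (u : L2 Ω) : L2 Ω :=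
  if h : ∃ g : L2 Ω, HasWeakPartial β u g then h.choose else 0

/-- The norm `‖u‖_m` of `H^m(Ω)`: the square root of `∑_{j ≤ m} ‖D^j u‖²`. -/
def hmNorm {d : ℕ} {Ω : Set (Pt d)} (m : ℕ) (u : L2 Ω) : ℝ :=
  Real.sqrt (∑ j ∈ Finset.range (m + 1), ∑ β : Fin j → Fin d, ‖weakPartial β u‖ ^ 2)

lemma mixedPartial_memLp {d m : ℕ} {Ω : Set (Pt d)} (β : Fin m → Fin d) {φ : Pt d → ℝ}
    (hφ : IsTest Ω φ) : MemLp (mixedPartial β φ) 2 (volume.restrict Ω) := by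
  have hc : Continuous (mixedPartial β φ) := by
    have h := hφ.smooth.continuous_iteratedFDeriv (m := m) (by exact_mod_cast le_top)
    unfold mixedPartial
    fun_prop
  have hs : HasCompactSupport (mixedPartial β φ) := by
    have h := hφ.compact.iteratedFDeriv (𝕜 := ℝ) m
    refine h.mono' ?_
    intro x hx
    refine subset_tsupport _ ?_
    intro h0
    apply hx
    simp [mixedPartial, h0]
  exact hc.memLp_of_hasCompactSupport hs

lemma test_memLp {d : ℕ} {Ω : Set (Pt d)} {φ : Pt d → ℝ}
    (hφ : IsTest Ω φ) : MemLp φ 2 (volume.restrict Ω) :=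
  hφ.smooth.continuous.memLp_of_hasCompactSupport hφ.compact

lemma integral_add_mul {d : ℕ} {Ω : Set (Pt d)} (u v : L2 Ω) {ψ : Pt d → ℝ}
    (hψ : MemLp ψ 2 (volume.restrict Ω)) :
    ∫ x in Ω, (u + v : L2 Ω) x * ψ x = (∫ x in Ω, u x * ψ x) + ∫ x in Ω, v x * ψ x := by
  have hu : Integrable (fun x => u x * ψ x) (volume.restrict Ω) := (Lp.memLp u).integrable_mul hψ
  have hv : Integrable (fun x => v x * ψ x) (volume.restrict Ω) := (Lp.memLp v).integrable_mul hψ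
  rw [← integral_add hu hv]
  refine integral_congr_ae ?_
  filter_upwards [Lp.coeFn_add u v] with x hx
  rw [hx]; simp [add_mul]

lemma integral_smul_mul {d : ℕ} {Ω : Set (Pt d)} (c : ℝ) (u : L2 Ω) (ψ : Pt d → ℝ) :
    ∫ x in Ω, (c • u : L2 Ω) x * ψ x = c * ∫ x in Ω, u x * ψ x := by
  rw [← integral_const_mul]
  refine integral_congr_ae ?_
  filter_upwards [Lp.coeFn_smul c u] with x hx
  rw [hx]; simp [mul_assoc]

lemma integral_zero_mul' {d : ℕ} {Ω : Set (Pt d)} (ψ : Pt d → ℝ) :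
    ∫ x in Ω, (0 : L2 Ω) x * ψ x = 0 := by
  have h := integral_smul_mul (Ω := Ω) 0 0 ψ
  simpa using h

/-- `H¹(Ω)`, realised as the space of pairs `(v, ∇v)` of an `L²` function and its weak gradient.
It carries the (product) topology of `L²`-convergence of the function and of its gradient. -/
def H1 {d : ℕ} (Ω : Set (Pt d)) : Submodule ℝ (L2 Ω × (Fin d → L2 Ω)) where
  carrier := {v | ∀ j : Fin d, HasWeakPartial (fun _ : Fin 1 => j) v.1 (v.2 j)}
  zero_mem' := by
    intro j φ _
    simp only [Prod.fst_zero, Prod.snd_zero, Pi.zero_apply]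
    rw [integral_zero_mul', integral_zero_mul', mul_zero]
  add_mem' := by
    intro u v hu hv j φ hφ
    simp only [Prod.fst_add, Prod.snd_add, Pi.add_apply]
    rw [integral_add_mul _ _ (mixedPartial_memLp _ hφ), integral_add_mul _ _ (test_memLp hφ),
      hu j φ hφ, hv j φ hφ, mul_add]
  smul_mem' := by
    intro c u hu j φ hφ
    simp only [Prod.smul_fst, Prod.smul_snd, Pi.smul_apply]
    rw [integral_smul_mul, integral_smul_mul, hu j φ hφ]
    ring

/-- The `L²` function underlying an element of `H¹(Ω)`. -/
def fn {d : ℕ} {Ω : Set (Pt d)} (v : H1 Ω) : L2 Ω := v.1.1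

/-- The weak partial derivative `∂_j v` of an element of `H¹(Ω)`. -/
def grad {d : ℕ} {Ω : Set (Pt d)} (v : H1 Ω) (j : Fin d) : L2 Ω := v.1.2 j

/-- The trace of `v ∈ H¹(Ω)` vanishes on `Γ ⊆ ∂Ω`: up to any `ε > 0`, `v` is the limit in `H¹(Ω)`
of functions that are smooth up to the boundary and whose restrictions to `Γ` tend to zero in
`L²(Γ)`, for the `(d-1)`-dimensional surface measure. -/
def HasZeroTrace {d : ℕ} {Ω : Set (Pt d)} (Γ : Set (Pt d)) (v : H1 Ω) : Prop :=
  ∀ ε : ℝ≥0∞, 0 < ε → ∃ φ : Pt d → ℝ, ContDiff ℝ ∞ φ ∧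
    eLpNorm (fun x => φ x - fn v x) 2 (volume.restrict Ω) ≤ ε ∧
    (∀ j, eLpNorm (fun x => fderiv ℝ φ x (e j) - grad v j x) 2 (volume.restrict Ω) ≤ ε) ∧
    eLpNorm φ 2 ((Measure.hausdorffMeasure ((d : ℝ) - 1)).restrict Γ) ≤ ε

lemma eLpNorm_sub_add_le {d : ℕ} {Ω : Set (Pt d)} {φ ψ : Pt d → ℝ} (hφ : Continuous φ)
    (hψ : Continuous ψ) (u v : L2 Ω) {ε : ℝ≥0∞}
    (h1 : eLpNorm (fun x => φ x - u x) 2 (volume.restrict Ω) ≤ ε / 2)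
    (h2 : eLpNorm (fun x => ψ x - v x) 2 (volume.restrict Ω) ≤ ε / 2) :
    eLpNorm (fun x => (φ x + ψ x) - (u + v : L2 Ω) x) 2 (volume.restrict Ω) ≤ ε := by
  have hE : (fun x => (φ x + ψ x) - (u + v : L2 Ω) x) =ᵐ[volume.restrict Ω]
      (fun x => φ x - u x) + (fun x => ψ x - v x) := by
    filter_upwards [Lp.coeFn_add u v] with x hx
    rw [hx]; simp; ring
  rw [eLpNorm_congr_ae hE]
  refine (eLpNorm_add_le (hφ.aestronglyMeasurable.sub (Lp.aestronglyMeasurable u))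
    (hψ.aestronglyMeasurable.sub (Lp.aestronglyMeasurable v)) (by norm_num)).trans ?_
  calc _ ≤ ε / 2 + ε / 2 := add_le_add h1 h2
    _ = ε := ENNReal.add_halves ε

lemma eLpNorm_sub_smul_le {d : ℕ} {Ω : Set (Pt d)} {φ : Pt d → ℝ} (c : ℝ) (u : L2 Ω) {ε : ℝ≥0∞}
    (h : eLpNorm (fun x => φ x - u x) 2 (volume.restrict Ω) ≤ ε / ‖c‖ₑ) :
    eLpNorm (fun x => c * φ x - (c • u : L2 Ω) x) 2 (volume.restrict Ω) ≤ ε := by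
  have hE : (fun x => c * φ x - (c • u : L2 Ω) x) =ᵐ[volume.restrict Ω]
      c • (fun x => φ x - u x) := by
    filter_upwards [Lp.coeFn_smul c u] with x hx
    rw [hx]; simp; ring
  rw [eLpNorm_congr_ae hE, eLpNorm_const_smul]
  calc _ ≤ ‖c‖ₑ * (ε / ‖c‖ₑ) := by gcongr
    _ ≤ ε := ENNReal.mul_div_le

lemma HasZeroTrace.smul {d : ℕ} {Ω Γ : Set (Pt d)} {u : H1 Ω} (hu : HasZeroTrace Γ u) (c : ℝ) :
    HasZeroTrace Γ (c • u) := by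
  intro ε hε
  have f1 : fn (c • u) = c • fn u := rfl
  have f2 : ∀ j, grad (c • u) j = c • grad u j := fun _ => rfl
  obtain ⟨φ, hφ, a1, a2, a3⟩ := hu (ε / ‖c‖ₑ) (ENNReal.div_pos hε.ne' (by simp))
  have dφ : Differentiable ℝ φ := hφ.differentiable (by simp)
  refine ⟨fun x => c * φ x, contDiff_const.mul hφ, ?_, fun j => ?_, ?_⟩
  · rw [f1]
    exact eLpNorm_sub_smul_le c (fn u) a1
  · have hd : ∀ x, fderiv ℝ (fun x => c * φ x) x (e j) = c * fderiv ℝ φ x (e j) := by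
      intro x
      rw [fderiv_const_mul (dφ x)]
      rfl
    simp only [hd, f2]
    exact eLpNorm_sub_smul_le c (grad u j) (a2 j)
  · have : (fun x => c * φ x) = c • φ := rfl
    rw [this, eLpNorm_const_smul]
    calc _ ≤ ‖c‖ₑ * (ε / ‖c‖ₑ) := by gcongr
      _ ≤ ε := ENNReal.mul_div_le

/-- `H¹_{0,Γ}(Ω)`. In particular `H¹_0(Ω)` is `H1zero Ω (frontier Ω)`. -/
def H1zero {d : ℕ} (Ω : Set (Pt d)) (Γ : Set (Pt d)) : Submodule ℝ (H1 Ω) where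
  carrier := {v | HasZeroTrace Γ v}
  zero_mem' := by
    intro ε _
    have h0 : ((0 : L2 Ω) : Pt d → ℝ) =ᵐ[volume.restrict Ω] 0 := Lp.coeFn_zero _ _ _
    have h1 : eLpNorm (fun x => -(0 : L2 Ω) x) 2 (volume.restrict Ω) = 0 := by
      rw [eLpNorm_congr_ae (g := 0) (by
        filter_upwards [h0] with x hx
        rw [hx]
        simp)]
      simp
    refine ⟨fun _ => 0, contDiff_const, ?_, fun j => ?_, by simp⟩
    · simp only [fn, zero_sub]
      exact h1.le.trans (zero_le)
    · simp only [grad, fderiv_fun_const, zero_sub]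
      refine le_trans (le_of_eq ?_) (zero_le)
      simpa using h1
  add_mem' := by
    intro u v hu hv ε hε
    obtain ⟨φ, hφ, a1, a2, a3⟩ := hu (ε / 2) (ENNReal.half_pos hε.ne')
    obtain ⟨ψ, hψ, b1, b2, b3⟩ := hv (ε / 2) (ENNReal.half_pos hε.ne')
    have dφ : Differentiable ℝ φ := hφ.differentiable (by simp)
    have dψ : Differentiable ℝ ψ := hψ.differentiable (by simp)
    have cφ := hφ.continuous_fderiv (by simp)
    have cψ := hψ.continuous_fderiv (by simp)
    refine ⟨fun x => φ x + ψ x, hφ.add hψ,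
      eLpNorm_sub_add_le hφ.continuous hψ.continuous (fn u) (fn v) a1 b1, fun j => ?_, ?_⟩
    · have h := eLpNorm_sub_add_le (φ := fun x => fderiv ℝ φ x (e j))
        (ψ := fun x => fderiv ℝ ψ x (e j)) (by fun_prop) (by fun_prop) (grad u j) (grad v j)
        (a2 j) (b2 j)
      refine le_of_eq_of_le ?_ h
      congr 1
      funext x
      rw [fderiv_fun_add (dφ x) (dψ x)]
      rfl
    · refine (eLpNorm_add_le hφ.continuous.aestronglyMeasurable
        hψ.continuous.aestronglyMeasurable (by norm_num)).trans ?_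
      calc _ ≤ ε / 2 + ε / 2 := add_le_add a3 b3
        _ = ε := ENNReal.add_halves ε
  smul_mem' := fun c _ hu => hu.smul c

/-- `V = H¹_{0,Γ_d}(Ω; ℝ^d)`. -/
def V {d : ℕ} (Ω Γd : Set (Pt d)) : Submodule ℝ (Fin d → H1 Ω) :=
  Submodule.pi Set.univ (fun _ => H1zero Ω Γd)

/-- The `H^m` norm of a vector field. -/
def vecHmNorm {d : ℕ} {Ω : Set (Pt d)} (m : ℕ) (u : Fin d → L2 Ω) : ℝ :=
  Real.sqrt (∑ i, hmNorm m (u i) ^ 2)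

/-- A polyhedral domain: open, connected, equal to the interior of its closure, with a closure
that is a finite union of nondegenerate closed `d`-simplices (hence bounded). -/
structure IsPolyhedralDomain {d : ℕ} (Ω : Set (Pt d)) : Prop where
  isOpen : IsOpen Ω
  isConnected : IsConnected Ω
  interior_closure : interior (closure Ω) = Ω
  triangulated : ∃ F : Set (Affine.Simplex ℝ (Pt d) d), F.Finite ∧
    closure Ω = ⋃ σ ∈ F, convexHull ℝ (Set.range σ.points)

/-! ### The medium: every datum other than the storage coefficients and `λ` -/

/-- `K i x` is the conductivity tensor of network `i` at `x`, and `ξ j i x` is `ξ_{j ← i}(x)`. -/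
structure Medium (d N : ℕ) where
  Ω : Set (Pt d)
  Γd : Set (Pt d)
  μ : ℝ
  α : Fin N → ℝ
  K : Fin N → Pt d → Matrix (Fin d) (Fin d) ℝ
  ξ : Fin N → Fin N → Pt d → ℝ

/-- The standing assumptions on domain, Dirichlet boundary and coefficients. -/
structure Medium.Admissible {d N : ℕ} (m : Medium d N) : Prop where
  dim : d = 2 ∨ d = 3
  domain : IsPolyhedralDomain m.Ω
  Γd_subset : m.Γd ⊆ frontier m.Ω
  Γd_meas : MeasurableSet m.Γd
  Γd_pos : 0 < Measure.hausdorffMeasure ((d : ℝ) - 1) m.Γd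
  Γt_pos : 0 < Measure.hausdorffMeasure ((d : ℝ) - 1) (frontier m.Ω \ m.Γd)
  μ_pos : 0 < m.μ
  α_mem : ∀ i, m.α i ∈ Ioc (0 : ℝ) 1
  K_meas : ∀ i j k, AEMeasurable (fun x => m.K i x j k) (volume.restrict m.Ω)
  K_symm : ∀ i, ∀ᵐ x ∂(volume.restrict m.Ω), (m.K i x).IsSymm
  K_elliptic : ∀ i, ∃ Klo Khi : ℝ, 0 < Klo ∧ 0 < Khi ∧ ∀ᵐ x ∂(volume.restrict m.Ω),
    ∀ v : Fin d → ℝ, Klo * ∑ j, v j ^ 2 ≤ dotProduct v ((m.K i x).mulVec v) ∧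
      dotProduct v ((m.K i x).mulVec v) ≤ Khi * ∑ j, v j ^ 2
  ξ_meas : ∀ j i, AEMeasurable (m.ξ j i) (volume.restrict m.Ω)
  ξ_nonneg : ∀ j i, ∀ᵐ x ∂(volume.restrict m.Ω), 0 ≤ m.ξ j i x
  ξ_symm : ∀ j i, ∀ᵐ x ∂(volume.restrict m.Ω), m.ξ j i x = m.ξ i j x
  ξ_bdd : ∃ B : ℝ, ∀ j i, ∀ᵐ x ∂(volume.restrict m.Ω), m.ξ j i x ≤ B

/-! ### Bilinear forms and norms -/

section forms

variable {d N : ℕ} {Ω : Set (Pt d)}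

/-- The `(i, j)` entry of `ε(u)`. -/
def strain (u : Fin d → H1 Ω) (i j : Fin d) : L2 Ω :=
  (1 / 2 : ℝ) • (grad (u i) j + grad (u j) i)

/-- `div u`. -/
def divg (u : Fin d → H1 Ω) : L2 Ω := ∑ i, grad (u i) i

/-- `⟨2 μ ε(u), ε(v)⟩`. -/
def elasticForm (μ : ℝ) (u v : Fin d → H1 Ω) : ℝ :=
  2 * μ * ∑ i, ∑ j, inner ℝ (strain u i j) (strain v i j)

/-- `‖v‖_V`. -/
def vNorm (μ : ℝ) (v : Fin d → H1 Ω) : ℝ := Real.sqrt (elasticForm μ v v)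

/-- `‖q‖_{Q_t}`. -/
def qtNorm (μ : ℝ) (q : L2 Ω) : ℝ := Real.sqrt ((2 * μ)⁻¹ * inner ℝ q q)

/-- `α · p`. -/
def dotα (α : Fin N → ℝ) (p : Fin N → L2 Ω) : L2 Ω := ∑ i, α i • p i

/-- `⟨ξ_i(p), q⟩`, where `ξ_i(p) = ∑_j ξ_{j ← i} (p_i - p_j)`. -/
def transferForm (ξ : Fin N → Fin N → Pt d → ℝ) (i : Fin N) (p : Fin N → L2 Ω) (q : L2 Ω) : ℝ :=
  ∫ x in Ω, (∑ j, ξ j i x * (p i x - p j x)) * q x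

/-- `⟨K ∇w, ∇q⟩`. -/
def diffusionForm (K : Pt d → Matrix (Fin d) (Fin d) ℝ) (w q : H1 Ω) : ℝ :=
  ∫ x in Ω, ∑ j, (∑ k, K x j k * grad w k x) * grad q j x

/-- `S(p, q)`. -/
def sForm (s α : Fin N → ℝ) (lam : ℝ) (p q : Fin N → L2 Ω) : ℝ :=
  (∑ i, s i * inner ℝ (p i) (q i)) + lam⁻¹ * inner ℝ (dotα α p) (dotα α q)

/-- `‖p‖_S`. -/
def sNorm (s α : Fin N → ℝ) (lam : ℝ) (p : Fin N → L2 Ω) : ℝ := Real.sqrt (sForm s α lam p p)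

end forms

/-! ### The continuous problem -/

section continuous

variable {d N : ℕ}

/-- The elasticity equation and the total pressure equation, in weak form, at one instant. -/
def SolvesStokes (m : Medium d N) (lam : ℝ) (f : Fin d → L2 m.Ω)
    (u : Fin d → H1 m.Ω) (pt : L2 m.Ω) (p : Fin N → L2 m.Ω) : Prop :=
  (∀ v ∈ V m.Ω m.Γd,
    elasticForm m.μ u v - inner ℝ pt (divg v) = ∑ i, inner ℝ (f i) (fn (v i))) ∧
  (∀ q : L2 m.Ω,
    -inner ℝ (divg u) q - lam⁻¹ * inner ℝ pt q + lam⁻¹ * inner ℝ (dotα m.α p) q = 0)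

/-- Compatible initial data, `f0` being the body force at time `0`. -/
structure IsCompatible (m : Medium d N) (lam : ℝ) (f0 : Fin d → L2 m.Ω)
    (u0 : Fin d → H1 m.Ω) (pt0 : L2 m.Ω) (p0 : Fin N → H1 m.Ω) : Prop where
  u_mem : u0 ∈ V m.Ω m.Γd
  p_mem : ∀ i, p0 i ∈ H1zero m.Ω (frontier m.Ω)
  stokes : SolvesStokes m lam f0 u0 pt0 (fun i => fn (p0 i))

/-- The time derivative, in `L²(Ω)`, of a function on `[0, T]`. -/
def dt {Ω : Set (Pt d)} (T : ℝ) (q : ℝ → L2 Ω) (t : ℝ) : L2 Ω := derivWithin q (Icc 0 T) t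

/-- `(u, pt, p)` solves the total pressure formulation on `[0, T]` with the given initial data. -/
structure IsSolution (m : Medium d N) (s : Fin N → ℝ) (lam T : ℝ)
    (f : ℝ → Fin d → L2 m.Ω) (g : ℝ → Fin N → L2 m.Ω)
    (u0 : Fin d → H1 m.Ω) (pt0 : L2 m.Ω) (p0 : Fin N → H1 m.Ω)
    (u : ℝ → Fin d → H1 m.Ω) (pt : ℝ → L2 m.Ω) (p : ℝ → Fin N → H1 m.Ω) : Prop where
  u_mem : ∀ t ∈ Icc 0 T, u t ∈ V m.Ω m.Γd
  p_mem : ∀ t ∈ Icc 0 T, ∀ i, p t i ∈ H1zero m.Ω (frontier m.Ω)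
  u_cont : ContinuousOn u (Icc 0 T)
  pt_cont : ContinuousOn pt (Icc 0 T)
  p_cont : ContinuousOn p (Icc 0 T)
  pt_diff : ContDiffOn ℝ 1 pt (Ioc 0 T)
  p_diff : ContDiffOn ℝ 1 p (Ioc 0 T)
  stokes : ∀ t ∈ Ioc 0 T, SolvesStokes m lam (f t) (u t) (pt t) (fun i => fn (p t i))
  diffusion : ∀ t ∈ Ioc 0 T, ∀ i, ∀ q ∈ H1zero m.Ω (frontier m.Ω),
    inner ℝ (s i • dt T (fun τ => fn (p τ i)) t
        + (m.α i * lam⁻¹) • (-dt T pt t + dotα m.α (fun k => dt T (fun τ => fn (p τ k)) t)))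
        (fn q)
      + transferForm m.ξ i (fun k => fn (p t k)) (fn q)
      + diffusionForm (m.K i) (p t i) q = inner ℝ (g t i) (fn q)
  u_init : u 0 = u0
  pt_init : pt 0 = pt0
  p_init : p 0 = p0

/-- Sufficient regularity of the exact solution, with all the norms involved bounded by `M`:
the norms of `u` in `L^∞(0,T; H^{ku+1})`, of `pt` in `L^∞(0,T; H^{ku})`, of each `p_i` in
`L^∞(0,T; H^{kp+1})`, and of `pt` and each `p_i` in `W^{3,∞}(0,T; L²)`. -/
structure IsRegular {Ω : Set (Pt d)} (ku kp : ℕ) (T M : ℝ)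
    (u : ℝ → Fin d → H1 Ω) (pt : ℝ → L2 Ω) (p : ℝ → Fin N → H1 Ω) : Prop where
  u_mem : ∀ t ∈ Icc 0 T, ∀ i, MemHm (ku + 1) (fn (u t i))
  u_le : ∀ t ∈ Icc 0 T, vecHmNorm (ku + 1) (fun i => fn (u t i)) ≤ M
  pt_mem : ∀ t ∈ Icc 0 T, MemHm ku (pt t)
  pt_le : ∀ t ∈ Icc 0 T, hmNorm ku (pt t) ≤ M
  p_mem : ∀ t ∈ Icc 0 T, ∀ i, MemHm (kp + 1) (fn (p t i))
  p_le : ∀ t ∈ Icc 0 T, ∀ i, hmNorm (kp + 1) (fn (p t i)) ≤ M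
  pt_smooth : ContDiffOn ℝ 3 pt (Icc 0 T)
  pt_deriv_le : ∀ j ≤ 3, ∀ t ∈ Icc 0 T, ‖iteratedDerivWithin j pt (Icc 0 T) t‖ ≤ M
  p_smooth : ∀ i, ContDiffOn ℝ 3 (fun t => fn (p t i)) (Icc 0 T)
  p_deriv_le : ∀ i, ∀ j ≤ 3, ∀ t ∈ Icc 0 T,
    ‖iteratedDerivWithin j (fun τ => fn (p τ i)) (Icc 0 T) t‖ ≤ M

end continuous

/-! ### The discretisation -/

/-- A symmetric primal discretisation of the Poisson operator in one network: the discrete space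
`Qh`, the discrete bilinear form `a`, and a mesh dependent energy norm. The form and the norm live
on a space `W` that contains `Qh` and (see `PressureMethod.Admissible`) the regular exact
pressures; their values off `W` are irrelevant. `Qh` need not be contained in `H¹(Ω)`, so that
nonconforming methods are allowed. For a conforming method `Qh ⊆ W = H¹_0(Ω)`,
`a(p, q) = ⟨K ∇p, ∇q⟩` and `energy q = a(q, q)^{1/2}`; for an interior penalty or enriched
Galerkin method `energy` is the usual mesh dependent norm, equivalent to `a(q, q)^{1/2}` on `Qh`. -/
structure PressureMethod {d : ℕ} (Ω : Set (Pt d)) where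
  W : Submodule ℝ (L2 Ω)
  Qh : Submodule ℝ (L2 Ω)
  a : L2 Ω → L2 Ω → ℝ
  energy : L2 Ω → ℝ
  Qh_le : Qh ≤ W
  finite : FiniteDimensional ℝ Qh
  a_add : ∀ u ∈ W, ∀ v ∈ W, ∀ w ∈ W, a (u + v) w = a u w + a v w
  a_smul : ∀ c : ℝ, ∀ u ∈ W, ∀ w ∈ W, a (c • u) w = c * a u w
  a_symm : ∀ u ∈ W, ∀ w ∈ W, a u w = a w u
  energy_nonneg : ∀ u ∈ W, 0 ≤ energy u
  energy_add : ∀ u ∈ W, ∀ v ∈ W, energy (u + v) ≤ energy u + energy v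
  energy_smul : ∀ c : ℝ, ∀ u ∈ W, energy (c • u) = |c| * energy u

/-- What makes `D` a method of order `k` for `⟨K ∇p, ∇q⟩` at mesh size `h`. -/
structure PressureMethod.Admissible {d : ℕ} {Ω : Set (Pt d)} (D : PressureMethod Ω)
    (K : Pt d → Matrix (Fin d) (Fin d) ℝ) (k : ℕ) (cStab cApp h : ℝ) : Prop where
  /-- consistency: if `w ∈ H¹_0 ∩ H^{k+1}` and `-div (K ∇w) = F ∈ L²`, then `w` satisfies the
  discrete equations -/
  consistent : ∀ w ∈ H1zero Ω (frontier Ω), MemHm (k + 1) (fn w) → ∀ F : L2 Ω,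
    (∀ q ∈ H1zero Ω (frontier Ω), diffusionForm K w q = inner ℝ F (fn q)) →
    fn w ∈ D.W ∧ ∀ q ∈ D.Qh, D.a (fn w) q = inner ℝ F q
  /-- boundedness -/
  bounded : ∀ w ∈ D.W, ∀ q ∈ D.Qh, |D.a w q| ≤ cStab * D.energy w * D.energy q
  /-- coercivity on the discrete space -/
  coercive : ∀ q ∈ D.Qh, D.energy q ^ 2 ≤ cStab * D.a q q
  /-- discrete Poincaré inequality -/
  poincare : ∀ w ∈ D.W, ‖w‖ ≤ cStab * D.energy w
  /-- approximation -/
  approx : ∀ w ∈ H1zero Ω (frontier Ω), MemHm (k + 1) (fn w) → fn w ∈ D.W →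
    ⨅ q : D.Qh, D.energy (fn w - q.1) ≤ cApp * h ^ k * hmNorm (k + 1) (fn w)

/-- The discrete spaces `V_h`, `Q_{t,h}` and the discretisations for the `N` networks. -/
structure Discretization {d N : ℕ} (m : Medium d N) where
  Vh : Submodule ℝ (Fin d → H1 m.Ω)
  Qth : Submodule ℝ (L2 m.Ω)
  net : Fin N → PressureMethod m.Ω

/-- The assumptions on the discretisation, with mesh size `h`, orders `ku`, `kp`, inf-sup constant
`β`, and constants `cStab`, `cApp` in the other bounds. -/
structure Discretization.Admissible {d N : ℕ} {m : Medium d N} (D : Discretization m)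
    (ku kp : ℕ) (β cStab cApp h : ℝ) : Prop where
  Vh_le : D.Vh ≤ V m.Ω m.Γd
  Vh_finite : FiniteDimensional ℝ D.Vh
  Qth_finite : FiniteDimensional ℝ D.Qth
  infsup : ∀ q ∈ D.Qth,
    β * qtNorm m.μ q ≤ ⨆ v : D.Vh, inner ℝ (divg v.1) q / vNorm m.μ v.1
  Vh_approx : ∀ u ∈ V m.Ω m.Γd, (∀ i, MemHm (ku + 1) (fn (u i))) →
    ⨅ v : D.Vh, vNorm m.μ (u - v.1) ≤ cApp * h ^ ku * vecHmNorm (ku + 1) (fun i => fn (u i))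
  Qth_approx : ∀ q : L2 m.Ω, MemHm ku q →
    ⨅ r : D.Qth, qtNorm m.μ (q - r.1) ≤ cApp * h ^ ku * hmNorm ku q
  net_adm : ∀ i, (D.net i).Admissible (m.K i) kp cStab cApp h

section discrete

variable {d N : ℕ} {m : Medium d N}

/-- `A(p, q)`. -/
def Discretization.aForm (D : Discretization m) (p q : Fin N → L2 m.Ω) : ℝ :=
  ∑ i, (transferForm m.ξ i p (q i) + (D.net i).a (p i) (q i))

/-- `‖p‖_A`. -/
def Discretization.aNorm (D : Discretization m) (p : Fin N → L2 m.Ω) : ℝ :=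
  Real.sqrt (D.aForm p p)

/-- A triple (displacement, total pressure, network pressures). -/
@[ext] structure State (m : Medium d N) where
  u : Fin d → H1 m.Ω
  pt : L2 m.Ω
  p : Fin N → L2 m.Ω

instance : Sub (State m) := ⟨fun X Y => ⟨X.u - Y.u, X.pt - Y.pt, X.p - Y.p⟩⟩

/-- The state belongs to `V_h × Q_{t,h} × ∏ Q_{i,h}`. -/
structure Discretization.Mem (D : Discretization m) (X : State m) : Prop where
  u_mem : X.u ∈ D.Vh
  pt_mem : X.pt ∈ D.Qth
  p_mem : ∀ i, X.p i ∈ (D.net i).Qh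

/-- `P = (Π^V u, Π^{Q_t} pt, Π^Q p)`: the Lamé projection of `(u, pt)` and the elliptic projection
of `p`. -/
structure Discretization.IsProjection (D : Discretization m) (lam : ℝ) (X P : State m) :
    Prop where
  mem : D.Mem P
  lame₁ : ∀ v ∈ D.Vh, elasticForm m.μ P.u v - inner ℝ P.pt (divg v)
    = elasticForm m.μ X.u v - inner ℝ X.pt (divg v)
  lame₂ : ∀ q ∈ D.Qth, -inner ℝ (divg P.u) q - lam⁻¹ * inner ℝ P.pt q
    = -inner ℝ (divg X.u) q - lam⁻¹ * inner ℝ X.pt q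
  elliptic : ∀ q : Fin N → L2 m.Ω, (∀ i, q i ∈ (D.net i).Qh) → D.aForm P.p q = D.aForm X.p q

/-- The assumption on the discrete initial state `X0h`: `X0` is the exact initial state and `P0` its
projection. -/
structure Discretization.IsInitial (D : Discretization m) (ku : ℕ) (cInit h : ℝ)
    (X0 P0 X0h : State m) : Prop where
  mem : D.Mem X0h
  p_eq : X0h.p = P0.p
  bound : vNorm m.μ (X0.u - X0h.u) + qtNorm m.μ (X0.pt - X0h.pt)
    ≤ cInit * h ^ ku * (vecHmNorm (ku + 1) (fun i => fn (X0.u i)) + hmNorm ku X0.pt)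

/-- The monolithic step from `X0h` to `X1h` with step size `τ`: backward Euler for the elasticity
and total pressure equations, Crank-Nicolson for the network pressures. Here `f1` is the body force
at the new time, and `g0`, `g1` are the sources at the old and at the new time. -/
structure Discretization.IsMonolithicStep (D : Discretization m) (s : Fin N → ℝ) (lam τ : ℝ)
    (f1 : Fin d → L2 m.Ω) (g0 g1 : Fin N → L2 m.Ω) (X0h X1h : State m) : Prop where
  mem : D.Mem X1h
  elasticity : ∀ v ∈ D.Vh,
    elasticForm m.μ X1h.u v - inner ℝ X1h.pt (divg v) = ∑ i, inner ℝ (f1 i) (fn (v i))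
  totalPressure : ∀ q ∈ D.Qth,
    -inner ℝ (divg X1h.u) q - lam⁻¹ * inner ℝ X1h.pt q
      + lam⁻¹ * inner ℝ (dotα m.α X1h.p) q = 0
  diffusion : ∀ i, ∀ q ∈ (D.net i).Qh,
    -inner ℝ (s i • (τ⁻¹ • (X1h.p i - X0h.p i))) q
      - (inner ℝ ((m.α i * lam⁻¹) • (-(τ⁻¹ • (X1h.pt - X0h.pt))
          + dotα m.α (τ⁻¹ • (X1h.p - X0h.p)))) q
        + transferForm m.ξ i ((1 / 2 : ℝ) • (X0h.p + X1h.p)) q)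
      - (D.net i).a ((1 / 2 : ℝ) • (X0h.p i + X1h.p i)) q
    = -inner ℝ ((1 / 2 : ℝ) • (g0 i + g1 i)) q

end discrete

/-- The exact state at time `t`. -/
def stateAt {d N : ℕ} {m : Medium d N} (u : ℝ → Fin d → H1 m.Ω) (pt : ℝ → L2 m.Ω)
    (p : ℝ → Fin N → H1 m.Ω) (t : ℝ) : State m :=
  ⟨u t, pt t, fun i => (fn (p t i))⟩

end MPET

end

/-! The proof is a single energy estimate for the discrete error at time `Δt`. Write `e_u`, `e_t`,
`e_p` for its displacement, total pressure and network pressure parts.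

The elasticity and total pressure equations are imposed at `Δt` itself, so exact and discrete
equations can be subtracted there. The Lamé projection absorbs everything except the elliptic
projection error of `α·p` (`stokes_energy_identity`). In the diffusion equations the exact
identities at the two ends are averaged and multiplied by `Δt`. The time derivatives then form a
trapezoidal rule, which misses the increment by `O(Δt³)`; the elliptic projection replaces the exact
pressures inside `A`; and since `p_h^0 = Πp^0`, the mean error over the step is `e_p / 2`, which
leaves `(Δt/2)‖e_p‖_A²` (`pressure_energy_identity`, `energy_balance`). Nothing is divided by `Δt`:
projection errors enter through their values at the two ends, so the powers of `h` carry no negative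
power of `Δt`.

Testing with the errors and adding gives `‖e_u‖_V² + λ⁻¹‖e_t - α·e_p‖² + ∑ s_i‖e_{p,i}‖² +
(Δt/2)‖e_p‖_A²` on the left and defects paired with errors on the right. The pressure term
degenerates along `e_t = α·e_p`; the inf-sup condition repairs this by bounding `e_t` by `e_u`
(`exists_energy_bound`). The estimate is uniform in the parameters because `λ` enters only through
`λ⁻¹ ≤ cLam / μ` and `s_i` only as a weight bounded by `sMax`.

It remains to bound the defects: by quasi-optimality of the two projections
(`exists_lame_projection_bound`, `exists_elliptic_projection_bound`), by the trapezoidal rule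
(`norm_trapezoid_sub_le`) and by the assumption on the initial state. The diffusion equations are
needed at `t = 0` as well, where they hold by continuity (`IsSolution.diffusionForm_eq`). -/

noncomputable section

namespace MPET

/-! ### Elasticity form and divergence -/

section elasticity

variable {d : ℕ} {Ω : Set (Pt d)}

lemma grad_add (u v : H1 Ω) (j : Fin d) : grad (u + v) j = grad u j + grad v j := rfl

lemma grad_smul (c : ℝ) (u : H1 Ω) (j : Fin d) : grad (c • u) j = c • grad u j := rfl

lemma divg_sub (u v : Fin d → H1 Ω) : divg (u - v) = divg u - divg v := by
  simp only [divg, ← Finset.sum_sub_distrib]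
  rfl

/-- `√(2μ) ε(u)` as an element of a Hilbert space. -/
def strainMap (μ : ℝ) : (Fin d → H1 Ω) →ₗ[ℝ] PiLp 2 (fun _ : Fin d × Fin d => L2 Ω) where
  toFun u := WithLp.toLp 2 (fun ij => Real.sqrt (2 * μ) • strain u ij.1 ij.2)
  map_add' u v := by
    ext1 ij
    simp only [strain, Pi.add_apply, grad_add, PiLp.add_apply]
    module
  map_smul' c u := by
    ext1 ij
    simp only [strain, Pi.smul_apply, grad_smul, PiLp.smul_apply, RingHom.id_apply]
    module

/-- Cauchy-Schwarz and the triangle inequality for `vNorm` are inherited from the target Hilbert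
space through a linear map. Definiteness plays no role, so Korn's inequality is not needed. -/
lemma elasticForm_eq_inner {μ : ℝ} (hμ : 0 ≤ μ) (u v : Fin d → H1 Ω) :
    elasticForm μ u v = inner ℝ (strainMap μ u) (strainMap μ v) := by
  have h : Real.sqrt (2 * μ) * Real.sqrt (2 * μ) = 2 * μ := Real.mul_self_sqrt (by positivity)
  simp only [elasticForm, PiLp.inner_apply, strainMap, LinearMap.coe_mk, AddHom.coe_mk,
    inner_smul_left, inner_smul_right, conj_trivial, Fintype.sum_prod_type, Finset.mul_sum]
  refine Finset.sum_congr rfl fun i _ => Finset.sum_congr rfl fun j _ => ?_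
  rw [← mul_assoc, h]

lemma vNorm_eq_norm {μ : ℝ} (hμ : 0 ≤ μ) (u : Fin d → H1 Ω) : vNorm μ u = ‖strainMap μ u‖ := by
  rw [vNorm, elasticForm_eq_inner hμ, real_inner_self_eq_norm_sq, Real.sqrt_sq (norm_nonneg _)]

lemma vNorm_nonneg (μ : ℝ) (u : Fin d → H1 Ω) : 0 ≤ vNorm μ u := Real.sqrt_nonneg _

lemma elasticForm_self {μ : ℝ} (hμ : 0 ≤ μ) (u : Fin d → H1 Ω) :
    elasticForm μ u u = vNorm μ u ^ 2 := by
  rw [vNorm_eq_norm hμ, elasticForm_eq_inner hμ, real_inner_self_eq_norm_sq]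

lemma abs_elasticForm_le {μ : ℝ} (hμ : 0 ≤ μ) (u v : Fin d → H1 Ω) :
    |elasticForm μ u v| ≤ vNorm μ u * vNorm μ v := by
  rw [elasticForm_eq_inner hμ, vNorm_eq_norm hμ, vNorm_eq_norm hμ]
  exact abs_real_inner_le_norm _ _

lemma elasticForm_sub_left {μ : ℝ} (hμ : 0 ≤ μ) (u w v : Fin d → H1 Ω) :
    elasticForm μ (u - w) v = elasticForm μ u v - elasticForm μ w v := by
  simp only [elasticForm_eq_inner hμ, map_sub, inner_sub_left]

lemma vNorm_sub_le {μ : ℝ} (hμ : 0 ≤ μ) (u v : Fin d → H1 Ω) :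
    vNorm μ (u - v) ≤ vNorm μ u + vNorm μ v := by
  simp only [vNorm_eq_norm hμ, map_sub]
  exact norm_sub_le _ _

lemma qtNorm_eq {μ : ℝ} (q : L2 Ω) :
    qtNorm μ q = (Real.sqrt (2 * μ))⁻¹ * ‖q‖ := by
  rw [qtNorm, real_inner_self_eq_norm_sq, Real.sqrt_mul' _ (sq_nonneg _),
    Real.sqrt_sq (norm_nonneg _), Real.sqrt_inv]

lemma norm_eq_qtNorm {μ : ℝ} (hμ : 0 < μ) (q : L2 Ω) :
    ‖q‖ = Real.sqrt (2 * μ) * qtNorm μ q := by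
  have : Real.sqrt (2 * μ) ≠ 0 := (Real.sqrt_pos.2 (by positivity)).ne'
  rw [qtNorm_eq]
  field_simp

/-- The constant in `‖div v‖ ≤ κ ‖v‖_V`. -/
def divConst (d : ℕ) (μ : ℝ) : ℝ := d * (Real.sqrt (2 * μ))⁻¹

lemma divConst_nonneg (d : ℕ) (μ : ℝ) : 0 ≤ divConst d μ := by unfold divConst; positivity

/-- The summands `∂_i v_i` are the diagonal entries of the strain, each bounded by the full strain
norm; adding them costs the factor `d`. -/
lemma norm_divg_le {μ : ℝ} (hμ : 0 < μ) (v : Fin d → H1 Ω) :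
    ‖divg v‖ ≤ divConst d μ * vNorm μ v := by
  have hs : 0 < Real.sqrt (2 * μ) := Real.sqrt_pos.2 (by positivity)
  have hi : ∀ i, ‖grad (v i) i‖ ≤ (Real.sqrt (2 * μ))⁻¹ * vNorm μ v := by
    intro i
    have h1 : ‖(strainMap μ v) (i, i)‖ ≤ ‖strainMap μ v‖ := PiLp.norm_apply_le _ _
    have h2 : (strainMap μ v) (i, i) = Real.sqrt (2 * μ) • grad (v i) i := by
      simp only [strainMap, LinearMap.coe_mk, AddHom.coe_mk, strain]
      module
    rw [h2, norm_smul, Real.norm_of_nonneg hs.le, ← vNorm_eq_norm hμ.le] at h1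
    rw [inv_mul_eq_div, le_div_iff₀ hs]
    linarith
  calc ‖divg v‖ ≤ ∑ i, ‖grad (v i) i‖ := norm_sum_le _ _
    _ ≤ ∑ _i : Fin d, (Real.sqrt (2 * μ))⁻¹ * vNorm μ v := Finset.sum_le_sum fun i _ => hi i
    _ = divConst d μ * vNorm μ v := by simp [divConst, mul_assoc]

lemma abs_inner_divg_le {μ : ℝ} (hμ : 0 < μ) (v : Fin d → H1 Ω) (q : L2 Ω) :
    |inner ℝ (divg v) q| ≤ divConst d μ * vNorm μ v * ‖q‖ :=
  (abs_real_inner_le_norm _ _).trans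
    (mul_le_mul_of_nonneg_right (norm_divg_le hμ v) (norm_nonneg _))

end elasticity

/-! ### The discrete inf-sup condition -/

section infsup

variable {d N : ℕ} {m : Medium d N} {D : Discretization m}
  {ku kp : ℕ} {β cStab cApp h : ℝ}

/-- The form in which the inf-sup condition gets used: a bound on the functional `v ↦ ⟨div v, q⟩`
over `V_h` is a bound on `q`. The factor `√(2μ)` passes from the `Q_t` norm to the `L²` norm. -/
lemma Discretization.Admissible.norm_le_of_inner_divg_le (hD : D.Admissible ku kp β cStab cApp h)
    {q : L2 m.Ω} (hq : q ∈ D.Qth) {c : ℝ} (hc : 0 ≤ c)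
    (H : ∀ v ∈ D.Vh, inner ℝ (divg v) q ≤ c * vNorm m.μ v) :
    β * (Real.sqrt (2 * m.μ))⁻¹ * ‖q‖ ≤ c := by
  have h2 : ∀ v : D.Vh, inner ℝ (divg v.1) q / vNorm m.μ v.1 ≤ c := by
    intro v
    rcases (vNorm_nonneg m.μ v.1).eq_or_lt with h0 | h0
    -- A `v` with `vNorm` zero contributes the quotient `0`, by the convention for division; this is
    -- where `0 ≤ c` enters.
    · rw [← h0, div_zero]; exact hc
    · exact (div_le_iff₀ h0).2 (H v.1 v.2)
  have h1 := hD.infsup q hq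
  have h3 : β * qtNorm m.μ q ≤ c := h1.trans (ciSup_le h2)
  calc β * (Real.sqrt (2 * m.μ))⁻¹ * ‖q‖ = β * qtNorm m.μ q := by rw [qtNorm_eq, mul_assoc]
    _ ≤ c := h3

end infsup

/-! ### Scalar inequalities -/

/-- If `x` were larger, then `w < x` would make the right side at most `2 B w x`, and cancelling `x`
gives a contradiction. -/
lemma le_of_sq_le_mul_add {x w B : ℝ} (hx : 0 ≤ x) (hw : 0 ≤ w) (hB : 0 ≤ B)
    (h : x ^ 2 ≤ B * w * (x + w)) : x ≤ (2 * B + 1) * w := by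
  by_contra! hlt
  have h0 : 0 ≤ B * w := by positivity
  have hwx : w < x := by nlinarith
  have : x * x ≤ (2 * B * w) * x := by nlinarith
  have := le_of_mul_le_mul_right this (by linarith)
  nlinarith

/-- The scalar core of quasi-optimality for the Lamé projection. Here `x`, `y` measure projection
minus competitor, `r`, `t` bound exact solution minus competitor, and `l` is `λ⁻¹`. Since `l` has no
positive lower bound, `y` is controlled by the second hypothesis (inf-sup), which turns the first
into an inequality for `x` alone. -/
lemma exists_saddle_bound {κ b Λ : ℝ} (hκ : 0 ≤ κ) (hb : 0 < b) (hΛ : 0 ≤ Λ) :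
    ∃ C : ℝ, 0 < C ∧ ∀ x y r t l : ℝ, 0 ≤ x → 0 ≤ y → 0 ≤ r → 0 ≤ t → 0 ≤ l → l ≤ Λ →
      x ^ 2 + l * y ^ 2 ≤ r * x + κ * t * x + κ * r * y + l * t * y →
      b * y ≤ x + r + κ * t → x ≤ C * (r + t) ∧ y ≤ C * (r + t) := by
  set k := 1 + κ + Λ with hk
  have hk1 : 1 ≤ k := by linarith
  set B := k + k ^ 2 / b with hB
  have hB0 : 0 ≤ B := by positivity
  refine ⟨(2 * B + 1) + k / b * ((2 * B + 1) + 1), by positivity, ?_⟩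
  intro x y r t l hx hy hr ht hl hlΛ h1 h2
  set w := r + t with hw
  have hw0 : 0 ≤ w := by positivity
  have hrw : r ≤ w := by linarith
  have htw : t ≤ w := by linarith
  have e1 : r + κ * t ≤ k * w := by nlinarith
  have e2 : κ * r + l * t ≤ k * w := by nlinarith
  have e3 : y ≤ k / b * (x + w) := by
    rw [div_mul_eq_mul_div, le_div_iff₀ hb]
    nlinarith
  have e4 : x ^ 2 ≤ B * w * (x + w) := by
    have h3 : x ^ 2 ≤ k * w * x + k * w * y := by
      have := mul_le_mul_of_nonneg_right e1 hx
      have := mul_le_mul_of_nonneg_right e2 hy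
      nlinarith [mul_nonneg hl (sq_nonneg y)]
    have h4 : k * w * y ≤ k * w * (k / b * (x + w)) :=
      mul_le_mul_of_nonneg_left e3 (by positivity)
    have h5 : B * w * (x + w) = k * w * x + k * w * w + k * w * (k / b * (x + w)) := by
      rw [hB]; ring
    have : 0 ≤ k * w * w := by positivity
    linarith
  have e5 := le_of_sq_le_mul_add hx hw0 hB0 e4
  have hkb : 0 ≤ k / b := by positivity
  constructor
  · have : 0 ≤ k / b * ((2 * B + 1) + 1) * w := by positivity
    linarith
  · have : k / b * (x + w) ≤ k / b * ((2 * B + 1) * w + w) := by gcongr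
    have : 0 ≤ (2 * B + 1) * w := by positivity
    linarith

/-! ### Multiplication by bounded functions, transfer and diffusion forms -/

section mul

variable {d : ℕ} {Ω : Set (Pt d)}

/-- Multiplication by a bounded function, as an operator on `L²(Ω)`. -/
def mulL2 {a : Pt d → ℝ} (ha : MemLp a ∞ (volume.restrict Ω)) : L2 Ω →L[ℝ] L2 Ω :=
  (ContinuousLinearMap.mul ℝ ℝ).holderL (volume.restrict Ω) ∞ 2 2 (ha.toLp a)

lemma coeFn_mulL2 {a : Pt d → ℝ} (ha : MemLp a ∞ (volume.restrict Ω)) (u : L2 Ω) :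
    mulL2 ha u =ᵐ[volume.restrict Ω] fun x => a x * u x := by
  filter_upwards [(ContinuousLinearMap.mul ℝ ℝ).coeFn_holder (r := 2) (ha.toLp a) u,
    ha.coeFn_toLp] with x h1 h2
  rw [← h2]
  exact h1

lemma inner_eq_integral (u v : L2 Ω) : inner ℝ u v = ∫ x in Ω, u x * v x := by
  rw [L2.inner_def]
  refine integral_congr_ae (Eventually.of_forall fun x => ?_)
  simp [mul_comm]

lemma integrable_mul_L2 (u v : L2 Ω) : Integrable (fun x => u x * v x) (volume.restrict Ω) :=
  (Lp.memLp u).integrable_mul (Lp.memLp v)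

lemma coeFn_sum_L2 {ι : Type*} (t : Finset ι) (u : ι → L2 Ω) :
    ((∑ i ∈ t, u i : L2 Ω) : Pt d → ℝ) =ᵐ[volume.restrict Ω] fun x => ∑ i ∈ t, u i x := by
  classical
  induction t using Finset.induction_on with
  | empty =>
    simp only [Finset.sum_empty]
    exact Lp.coeFn_zero ℝ 2 (volume.restrict Ω)
  | insert a t ha ih =>
    rw [Finset.sum_insert ha]
    filter_upwards [Lp.coeFn_add (u a) (∑ i ∈ t, u i), ih] with x h1 h2
    rw [h1, Finset.sum_insert ha, Pi.add_apply, h2]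

lemma inner_mulL2_self_nonneg {a : Pt d → ℝ} (ha : MemLp a ∞ (volume.restrict Ω))
    (h0 : ∀ᵐ x ∂(volume.restrict Ω), 0 ≤ a x) (u : L2 Ω) : 0 ≤ inner ℝ (mulL2 ha u) u := by
  rw [inner_eq_integral]
  refine integral_nonneg_of_ae ?_
  filter_upwards [coeFn_mulL2 ha u, h0] with x h1 h2
  rw [h1, mul_assoc]
  exact mul_nonneg h2 (mul_self_nonneg _)

lemma mulL2_congr {a b : Pt d → ℝ} (ha : MemLp a ∞ (volume.restrict Ω))
    (hb : MemLp b ∞ (volume.restrict Ω)) (h : a =ᵐ[volume.restrict Ω] b) :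
    mulL2 ha = mulL2 hb := by
  unfold mulL2
  rw [(MemLp.toLp_eq_toLp_iff ha hb).2 h]

end mul

section transfer

variable {d N : ℕ} {Ω : Set (Pt d)} {ξ : Fin N → Fin N → Pt d → ℝ}

/-- `ξ_i(p)` as an element of `L²(Ω)`. -/
def transferL2 (hξ : ∀ j i, MemLp (ξ j i) ∞ (volume.restrict Ω)) (i : Fin N)
    (p : Fin N → L2 Ω) : L2 Ω :=
  ∑ j, mulL2 (hξ j i) (p i - p j)

lemma transferForm_eq_inner (hξ : ∀ j i, MemLp (ξ j i) ∞ (volume.restrict Ω)) (i : Fin N)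
    (p : Fin N → L2 Ω) (q : L2 Ω) :
    transferForm ξ i p q = inner ℝ (transferL2 hξ i p) q := by
  rw [inner_eq_integral, transferForm]
  refine integral_congr_ae ?_
  have h2 : ∀ᵐ x ∂(volume.restrict Ω), ∀ j,
      mulL2 (hξ j i) (p i - p j) x = ξ j i x * (p i x - p j x) := by
    rw [ae_all_iff]
    intro j
    filter_upwards [coeFn_mulL2 (hξ j i) (p i - p j), Lp.coeFn_sub (p i) (p j)] with x h1 h2
    rw [h1, h2, Pi.sub_apply]
  filter_upwards [coeFn_sum_L2 Finset.univ fun j => mulL2 (hξ j i) (p i - p j), h2] with x h1 h2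
  simp only [transferL2]
  rw [h1]
  simp only [h2]

lemma transferL2_add (hξ : ∀ j i, MemLp (ξ j i) ∞ (volume.restrict Ω)) (i : Fin N)
    (p q : Fin N → L2 Ω) :
    transferL2 hξ i (p + q) = transferL2 hξ i p + transferL2 hξ i q := by
  simp only [transferL2, ← Finset.sum_add_distrib, ← map_add, Pi.add_apply]
  refine Finset.sum_congr rfl fun j _ => ?_
  congr 1
  abel

lemma transferL2_smul (hξ : ∀ j i, MemLp (ξ j i) ∞ (volume.restrict Ω)) (i : Fin N)
    (c : ℝ) (p : Fin N → L2 Ω) : transferL2 hξ i (c • p) = c • transferL2 hξ i p := by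
  simp only [transferL2, Finset.smul_sum, ← map_smul, Pi.smul_apply, smul_sub]

lemma norm_transferL2_le (hξ : ∀ j i, MemLp (ξ j i) ∞ (volume.restrict Ω)) (i : Fin N)
    {p : Fin N → L2 Ω} {B c : ℝ} (hB : ∀ j, ‖mulL2 (hξ j i)‖ ≤ B) (hc : ∀ j, ‖p j‖ ≤ c) :
    ‖transferL2 hξ i p‖ ≤ N * (B * (2 * c)) := by
  refine (norm_sum_le _ _).trans ?_
  have : ∀ j ∈ (Finset.univ : Finset (Fin N)), ‖mulL2 (hξ j i) (p i - p j)‖ ≤ B * (2 * c) := by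
    intro j _
    have h1 : ‖p i - p j‖ ≤ 2 * c := (norm_sub_le _ _).trans (by linarith [hc i, hc j])
    exact (ContinuousLinearMap.le_opNorm _ _).trans
      (mul_le_mul (hB j) h1 (norm_nonneg _) ((norm_nonneg _).trans (hB j)))
  exact (Finset.sum_le_sum this).trans (by simp)

/-- Symmetrisation: exchanging the two indices and averaging turns the sum into half of `∑_{i,j}
⟨ξ_{ji}(p_i - p_j), p_i - p_j⟩`. -/
lemma sum_transferForm_self_nonneg (hξ : ∀ j i, MemLp (ξ j i) ∞ (volume.restrict Ω))
    (h0 : ∀ j i, ∀ᵐ x ∂(volume.restrict Ω), 0 ≤ ξ j i x)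
    (hs : ∀ j i, ∀ᵐ x ∂(volume.restrict Ω), ξ j i x = ξ i j x) (p : Fin N → L2 Ω) :
    0 ≤ ∑ i, transferForm ξ i p (p i) := by
  have h1 : ∑ i, transferForm ξ i p (p i)
      = ∑ i, ∑ j, inner ℝ (mulL2 (hξ j i) (p i - p j)) (p i) := by
    refine Finset.sum_congr rfl fun i _ => ?_
    rw [transferForm_eq_inner hξ, transferL2, sum_inner]
  have h2 : ∑ i, transferForm ξ i p (p i)
      = ∑ i, ∑ j, -inner ℝ (mulL2 (hξ j i) (p i - p j)) (p j) := by
    rw [h1, Finset.sum_comm]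
    refine Finset.sum_congr rfl fun i _ => Finset.sum_congr rfl fun j _ => ?_
    rw [mulL2_congr (hξ i j) (hξ j i) (hs i j), ← neg_sub (p i), map_neg, inner_neg_left]
  have h3 : 2 * ∑ i, transferForm ξ i p (p i)
      = ∑ i, ∑ j, inner ℝ (mulL2 (hξ j i) (p i - p j)) (p i - p j) := by
    rw [two_mul]
    nth_rewrite 1 [h1]
    rw [h2]
    simp only [← Finset.sum_add_distrib]
    refine Finset.sum_congr rfl fun i _ => Finset.sum_congr rfl fun j _ => ?_
    rw [inner_sub_right]
    ring
  have h4 : 0 ≤ ∑ i, ∑ j, inner ℝ (mulL2 (hξ j i) (p i - p j)) (p i - p j) :=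
    Finset.sum_nonneg fun i _ => Finset.sum_nonneg fun j _ =>
      inner_mulL2_self_nonneg (hξ j i) (h0 j i) _
  linarith

end transfer

section diffusion

variable {d : ℕ} {Ω : Set (Pt d)} {K : Pt d → Matrix (Fin d) (Fin d) ℝ}

/-- This makes continuity of the form in `w`, for the topology of `H¹`, evident; the passage to `t =
0` relies on it. -/
lemma diffusionForm_eq_inner (hK : ∀ j k, MemLp (fun x => K x j k) ∞ (volume.restrict Ω))
    (w q : H1 Ω) :
    diffusionForm K w q = ∑ j, inner ℝ (∑ k, mulL2 (hK j k) (grad w k)) (grad q j) := by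
  have h2 : ∀ᵐ x ∂(volume.restrict Ω), ∀ j,
      (∑ k, mulL2 (hK j k) (grad w k) : L2 Ω) x = ∑ k, K x j k * grad w k x := by
    rw [ae_all_iff]
    intro j
    have h3 : ∀ᵐ x ∂(volume.restrict Ω), ∀ k,
        mulL2 (hK j k) (grad w k) x = K x j k * grad w k x :=
      ae_all_iff.2 fun k => coeFn_mulL2 (hK j k) (grad w k)
    filter_upwards [coeFn_sum_L2 Finset.univ fun k => mulL2 (hK j k) (grad w k), h3] with x h4 h5
    rw [h4]
    simp only [h5]
  simp only [inner_eq_integral]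
  rw [← integral_finsetSum _ fun j _ => integrable_mul_L2 _ _]
  refine integral_congr_ae ?_
  filter_upwards [h2] with x h3
  simp only [h3]

/-- Polarisation: test with `e_j`, `e_k` and `e_j + e_k`. -/
lemma abs_entry_le_of_quadratic_bounds {A : Matrix (Fin d) (Fin d) ℝ} (hA : A.IsSymm) {c : ℝ}
    (h : ∀ v : Fin d → ℝ, 0 ≤ dotProduct v (A.mulVec v) ∧
      dotProduct v (A.mulVec v) ≤ c * ∑ j, v j ^ 2) (j k : Fin d) : |A j k| ≤ 2 * c := by
  have hq : ∀ i l, dotProduct (Pi.single i 1) (A.mulVec (Pi.single l (1 : ℝ))) = A i l := by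
    intro i l
    simp
  have hs : ∀ i : Fin d, ∑ l, (Pi.single i (1 : ℝ) : Fin d → ℝ) l ^ 2 = 1 := by
    intro i
    simp [Pi.single_apply]
  have hd : ∀ i, 0 ≤ A i i ∧ A i i ≤ c := by
    intro i
    have := h (Pi.single i 1)
    rwa [hq, hs, mul_one] at this
  have hp := h (Pi.single j 1 + Pi.single k 1)
  have e1 : dotProduct (Pi.single j (1 : ℝ) + Pi.single k 1)
      (A.mulVec (Pi.single j 1 + Pi.single k 1)) = A j j + A k k + 2 * A j k := by
    rw [Matrix.mulVec_add, add_dotProduct, dotProduct_add, dotProduct_add, hq, hq, hq, hq,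
      hA.apply j k]
    ring
  -- The value is `2` for `j ≠ k` and `4` for `j = k`; the bound `4` covers both without a case
  -- split.
  have e2 : ∑ l, (Pi.single j (1 : ℝ) + Pi.single k 1 : Fin d → ℝ) l ^ 2 ≤ 4 := by
    calc _ ≤ ∑ l, (2 * (Pi.single j (1 : ℝ) : Fin d → ℝ) l ^ 2
          + 2 * (Pi.single k (1 : ℝ) : Fin d → ℝ) l ^ 2) := by
          refine Finset.sum_le_sum fun l _ => ?_
          simp only [Pi.add_apply]
          nlinarith [sq_nonneg ((Pi.single j (1 : ℝ) : Fin d → ℝ) l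
            - (Pi.single k (1 : ℝ) : Fin d → ℝ) l)]
      _ = 4 := by
          rw [Finset.sum_add_distrib, ← Finset.mul_sum, ← Finset.mul_sum, hs, hs]
          norm_num
  rw [e1] at hp
  have hc : 0 ≤ c := (hd j).1.trans (hd j).2
  have := mul_le_mul_of_nonneg_left e2 hc
  rw [abs_le]
  constructor <;> linarith [hp.1, hp.2, (hd j).1, (hd j).2, (hd k).1, (hd k).2]

end diffusion

/-! ### Boundedness of the coefficients of the medium -/

section medium

variable {d N : ℕ} {m : Medium d N}

lemma Medium.Admissible.ξ_memLp (hm : m.Admissible) (j i : Fin N) :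
    MemLp (m.ξ j i) ∞ (volume.restrict m.Ω) := by
  obtain ⟨B, hB⟩ := hm.ξ_bdd
  refine memLp_top_of_bound (hm.ξ_meas j i).aestronglyMeasurable B ?_
  filter_upwards [hB j i, hm.ξ_nonneg j i] with x h1 h2
  rwa [Real.norm_of_nonneg h2]

lemma Medium.Admissible.K_memLp (hm : m.Admissible) (i : Fin N) (j k : Fin d) :
    MemLp (fun x => m.K i x j k) ∞ (volume.restrict m.Ω) := by
  obtain ⟨Klo, Khi, h0, -, hK⟩ := hm.K_elliptic i
  refine memLp_top_of_bound (hm.K_meas i j k).aestronglyMeasurable (2 * Khi) ?_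
  filter_upwards [hK, hm.K_symm i] with x h1 h2
  exact abs_entry_le_of_quadratic_bounds h2
    (fun v => ⟨le_trans (by positivity) (h1 v).1, (h1 v).2⟩) j k

end medium

/-! ### The exact solution: trapezoidal rule, and the pressure equations up to `t = 0` -/

/-- Expand `f` to second and `f'` to first order at `0`. The Taylor polynomials cancel in the
trapezoidal rule, and each remainder contributes `M τ³ / 2`. -/
lemma norm_trapezoid_sub_le {E : Type*} [NormedAddCommGroup E] [NormedSpace ℝ E] {f : ℝ → E}
    {T M τ : ℝ} (hτ : 0 < τ) (hτT : τ ≤ T) (hf : ContDiffOn ℝ 3 f (Icc 0 T))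
    (hM : ∀ t ∈ Icc 0 T, ‖iteratedDerivWithin 3 f (Icc 0 T) t‖ ≤ M) :
    ‖(τ / 2) • (derivWithin f (Icc 0 T) 0 + derivWithin f (Icc 0 T) τ) - (f τ - f 0)‖
      ≤ M * τ ^ 3 := by
  have hT : 0 < T := hτ.trans_le hτT
  have hmem : τ ∈ Icc 0 T := ⟨hτ.le, hτT⟩
  have hu : UniqueDiffOn ℝ (Icc 0 T) := uniqueDiffOn_Icc hT
  have h1 := taylor_mean_remainder_bound (n := 2) hT.le (by exact_mod_cast hf) hmem hM
  have hf' : ContDiffOn ℝ 2 (derivWithin f (Icc 0 T)) (Icc 0 T) :=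
    hf.derivWithin hu (by norm_num)
  have h2 := taylor_mean_remainder_bound (n := 1) (C := M) hT.le (by exact_mod_cast hf') hmem
    (fun y hy => by
      rw [← iteratedDerivWithin_succ']
      exact hM y hy)
  have e2 : iteratedDerivWithin 2 f (Icc 0 T) 0
      = derivWithin (derivWithin f (Icc 0 T)) (Icc 0 T) 0 := by
    rw [iteratedDerivWithin_succ', iteratedDerivWithin_one]
  set f1 := derivWithin f (Icc 0 T) with hf1
  simp only [taylorWithinEval_succ, taylor_within_zero_eval, e2, sub_zero] at h1 h2
  norm_num [Nat.factorial] at h1 h2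
  set a := derivWithin f1 (Icc 0 T) 0
  have key : (τ / 2) • (f1 0 + f1 τ) - (f τ - f 0)
      = (τ / 2) • (f1 τ - (f1 0 + τ • a))
        - (f τ - (f 0 + τ • f1 0 + (1 / 2 * τ ^ 2) • a)) := by
    module
  rw [key]
  have h3 : ‖(τ / 2) • (f1 τ - (f1 0 + τ • a))‖ ≤ τ / 2 * (M * τ ^ 2) := by
    rw [norm_smul, Real.norm_of_nonneg (by positivity)]
    exact mul_le_mul_of_nonneg_left h2 (by positivity)
  refine (norm_sub_le _ _).trans ?_
  calc _ ≤ τ / 2 * (M * τ ^ 2) + M * τ ^ 3 / 2 := add_le_add h3 h1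
    _ = M * τ ^ 3 := by ring

section closed

variable {d N : ℕ} {m : Medium d N} {s : Fin N → ℝ} {lam T M : ℝ} {ku kp : ℕ}
  {f : ℝ → Fin d → L2 m.Ω} {g : ℝ → Fin N → L2 m.Ω}
  {u0 : Fin d → H1 m.Ω} {pt0 : L2 m.Ω} {p0 : Fin N → H1 m.Ω}
  {u : ℝ → Fin d → H1 m.Ω} {pt : ℝ → L2 m.Ω} {p : ℝ → Fin N → H1 m.Ω}

lemma continuous_fn {d : ℕ} {Ω : Set (Pt d)} : Continuous (fn : H1 Ω → L2 Ω) :=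
  continuous_fst.comp continuous_subtype_val

lemma continuous_grad {d : ℕ} {Ω : Set (Pt d)} (j : Fin d) :
    Continuous (fun v : H1 Ω => grad v j) :=
  (continuous_apply j).comp (continuous_snd.comp continuous_subtype_val)

/-- The `L²` function `F` for which `-div (K_i ∇ p_i) = F`. -/
def fluxSource (hm : m.Admissible) (s : Fin N → ℝ) (lam T : ℝ) (g : ℝ → Fin N → L2 m.Ω)
    (pt : ℝ → L2 m.Ω) (p : ℝ → Fin N → H1 m.Ω) (t : ℝ) (i : Fin N) : L2 m.Ω :=
  g t i - (s i • dt T (fun τ => fn (p τ i)) t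
    + (m.α i * lam⁻¹) • (-dt T pt t + dotα m.α (fun k => dt T (fun τ => fn (p τ k)) t)))
    - transferL2 hm.ξ_memLp i (fun k => fn (p t k))

/-- The equation is given on `(0, T]` only, but the Crank-Nicolson comparison needs it at `0`. Both
sides are continuous on `[0, T]`: the left by continuity of `p` into `H¹`, the right by the `C³`
regularity in `L²`, which includes one-sided derivatives at the ends. -/
lemma IsSolution.diffusionForm_eq (hm : m.Admissible) (hT : 0 < T)
    (hg : ContinuousOn g (Icc 0 T)) (hs : IsSolution m s lam T f g u0 pt0 p0 u pt p)
    (hr : IsRegular ku kp T M u pt p) (i : Fin N) {q : H1 m.Ω}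
    (hq : q ∈ H1zero m.Ω (frontier m.Ω)) {t : ℝ} (ht : t ∈ Icc 0 T) :
    diffusionForm (m.K i) (p t i) q = inner ℝ (fluxSource hm s lam T g pt p t i) (fn q) := by
  have hu : UniqueDiffOn ℝ (Icc 0 T) := uniqueDiffOn_Icc hT
  have hpi : ∀ k, ContinuousOn (fun t => p t k) (Icc 0 T) := fun k =>
    (continuous_apply k).comp_continuousOn hs.p_cont
  have hfn : ∀ k, ContinuousOn (fun t => fn (p t k)) (Icc 0 T) := fun k =>
    continuous_fn.comp_continuousOn (hpi k)
  have hgr : ∀ k, ContinuousOn (fun t => grad (p t i) k) (Icc 0 T) := fun k =>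
    (continuous_grad k).comp_continuousOn (hpi i)
  have hdp : ∀ k, ContinuousOn (dt T (fun τ => fn (p τ k))) (Icc 0 T) := fun k =>
    (hr.p_smooth k).continuousOn_derivWithin hu (by norm_num)
  have hdpt : ContinuousOn (dt T pt) (Icc 0 T) :=
    hr.pt_smooth.continuousOn_derivWithin hu (by norm_num)
  have hgi : ContinuousOn (fun t => g t i) (Icc 0 T) :=
    (continuous_apply i).comp_continuousOn hg
  have hdot : ContinuousOn (fun t => dotα m.α (fun k => dt T (fun τ => fn (p τ k)) t))
      (Icc 0 T) := continuousOn_finsetSum _ fun k _ => (hdp k).const_smul (m.α k)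
  have htr : ContinuousOn (fun t => transferL2 hm.ξ_memLp i (fun k => fn (p t k))) (Icc 0 T) :=
    continuousOn_finsetSum _ fun k _ =>
      (mulL2 (hm.ξ_memLp k i)).continuous.comp_continuousOn ((hfn i).sub (hfn k))
  have hA : ContinuousOn (fun t => s i • dt T (fun τ => fn (p τ i)) t) (Icc 0 T) :=
    (hdp i).const_smul (s i)
  have hB : ContinuousOn (fun t => (m.α i * lam⁻¹) • (-dt T pt t
      + dotα m.α (fun k => dt T (fun τ => fn (p τ k)) t))) (Icc 0 T) :=
    (hdpt.neg.add hdot).const_smul (m.α i * lam⁻¹)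
  have hF : ContinuousOn (fun t => fluxSource hm s lam T g pt p t i) (Icc 0 T) :=
    (hgi.sub (hA.add hB)).sub htr
  have hL : ContinuousOn (fun t => diffusionForm (m.K i) (p t i) q) (Icc 0 T) := by
    simp only [diffusionForm_eq_inner (hm.K_memLp i)]
    refine continuousOn_finsetSum _ fun j _ => ContinuousOn.inner ?_ continuousOn_const
    exact continuousOn_finsetSum _ fun k _ =>
      (mulL2 (hm.K_memLp i j k)).continuous.comp_continuousOn (hgr k)
  have hR : ContinuousOn (fun t => inner ℝ (fluxSource hm s lam T g pt p t i) (fn q))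
      (Icc 0 T) := hF.inner continuousOn_const
  refine EqOn.of_subset_closure (s := Ioc 0 T) (t := Icc 0 T) ?_ hL hR
    Ioc_subset_Icc_self (closure_Ioc hT.ne).ge ht
  intro t ht
  have h := hs.diffusion t ht i q hq
  rw [transferForm_eq_inner hm.ξ_memLp] at h
  simp only [fluxSource, inner_sub_left]
  linarith

/-- The exact equation acquires discrete test functions, which need not lie in `H¹_0`; for this the
source has to be an `L²` function. -/
lemma IsSolution.discrete_consistency (hm : m.Admissible) (hT : 0 < T)
    (hg : ContinuousOn g (Icc 0 T)) (hs : IsSolution m s lam T f g u0 pt0 p0 u pt p)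
    (hr : IsRegular ku kp T M u pt p) {D : Discretization m} {β cStab cApp h : ℝ}
    (hD : D.Admissible ku kp β cStab cApp h) (i : Fin N) {t : ℝ} (ht : t ∈ Icc 0 T) :
    fn (p t i) ∈ (D.net i).W ∧ ∀ q ∈ (D.net i).Qh,
      (D.net i).a (fn (p t i)) q = inner ℝ (fluxSource hm s lam T g pt p t i) q :=
  (hD.net_adm i).consistent (p t i) (hs.p_mem t ht i) (hr.p_mem t ht i) _
    fun _ hq => hs.diffusionForm_eq hm hT hg hr i hq ht

end closed

/-! ### The discrete pressure form -/

section aForm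

lemma PressureMethod.a_sub {d : ℕ} {Ω : Set (Pt d)} (D : PressureMethod Ω) {u v w : L2 Ω}
    (hu : u ∈ D.W) (hv : v ∈ D.W) (hw : w ∈ D.W) : D.a (u - v) w = D.a u w - D.a v w := by
  have h : u - v = u + (-1 : ℝ) • v := by module
  rw [h, D.a_add _ hu _ (D.W.smul_mem _ hv) _ hw, D.a_smul _ _ hv _ hw]
  ring

variable {d N : ℕ} {m : Medium d N} {D : Discretization m}

lemma Discretization.aForm_sub (hm : m.Admissible) {p q r : Fin N → L2 m.Ω}
    (hp : ∀ i, p i ∈ (D.net i).W) (hq : ∀ i, q i ∈ (D.net i).W) (hr : ∀ i, r i ∈ (D.net i).W) :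
    D.aForm (p - q) r = D.aForm p r - D.aForm q r := by
  have h : p - q = p + (-1 : ℝ) • q := by module
  simp only [Discretization.aForm, ← Finset.sum_sub_distrib]
  refine Finset.sum_congr rfl fun i _ => ?_
  rw [Pi.sub_apply, (D.net i).a_sub (hp i) (hq i) (hr i)]
  simp only [transferForm_eq_inner hm.ξ_memLp]
  rw [h, transferL2_add, transferL2_smul, inner_add_left, inner_smul_left]
  simp only [conj_trivial]
  ring

lemma Discretization.aForm_smul (hm : m.Admissible) (c : ℝ) {p r : Fin N → L2 m.Ω}
    (hp : ∀ i, p i ∈ (D.net i).W) (hr : ∀ i, r i ∈ (D.net i).W) :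
    D.aForm (c • p) r = c * D.aForm p r := by
  simp only [Discretization.aForm, Finset.mul_sum]
  refine Finset.sum_congr rfl fun i _ => ?_
  rw [Pi.smul_apply, (D.net i).a_smul c _ (hp i) _ (hr i)]
  simp only [transferForm_eq_inner hm.ξ_memLp]
  rw [transferL2_smul, inner_smul_left]
  simp only [conj_trivial]
  ring

variable {ku kp : ℕ} {β cStab cApp h : ℝ}

lemma Discretization.sum_energy_sq_le (hm : m.Admissible) (hc : 0 ≤ cStab)
    (hD : D.Admissible ku kp β cStab cApp h) {q : Fin N → L2 m.Ω}
    (hq : ∀ i, q i ∈ (D.net i).Qh) :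
    ∑ i, (D.net i).energy (q i) ^ 2 ≤ cStab * D.aForm q q := by
  have h1 := sum_transferForm_self_nonneg hm.ξ_memLp hm.ξ_nonneg hm.ξ_symm q
  have h2 : ∑ i, (D.net i).energy (q i) ^ 2 ≤ cStab * ∑ i, (D.net i).a (q i) (q i) := by
    rw [Finset.mul_sum]
    exact Finset.sum_le_sum fun i _ => (hD.net_adm i).coercive _ (hq i)
  rw [Discretization.aForm, Finset.sum_add_distrib, mul_add]
  nlinarith [mul_nonneg hc h1]

lemma Discretization.aForm_self_nonneg (hm : m.Admissible) (hc : 0 < cStab)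
    (hD : D.Admissible ku kp β cStab cApp h) {q : Fin N → L2 m.Ω}
    (hq : ∀ i, q i ∈ (D.net i).Qh) : 0 ≤ D.aForm q q := by
  have h1 := Discretization.sum_energy_sq_le hm hc.le hD hq
  have h2 : 0 ≤ ∑ i, (D.net i).energy (q i) ^ 2 := Finset.sum_nonneg fun i _ => sq_nonneg _
  exact nonneg_of_mul_nonneg_right (h2.trans h1) hc

/-- Céa's argument: by Galerkin orthogonality `A(P - r, P - r) = A(p - r, P - r)`, then coercivity
against boundedness. The `L²` bound comes from the discrete Poincaré inequality, at the order of the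
energy error and without duality. -/
lemma exists_elliptic_projection_bound (hm : m.Admissible) (hc : 0 < cStab) :
    ∃ C : ℝ, 0 < C ∧ ∀ (D : Discretization m) (ku kp : ℕ) (β cApp h : ℝ),
      D.Admissible ku kp β cStab cApp h → ∀ (ρ : ℝ) (p P : Fin N → L2 m.Ω), 0 ≤ ρ →
      (∀ i, p i ∈ (D.net i).W) → (∀ i, P i ∈ (D.net i).Qh) →
      (∀ q : Fin N → L2 m.Ω, (∀ i, q i ∈ (D.net i).Qh) → D.aForm P q = D.aForm p q) →
      (∀ i, ∃ r ∈ (D.net i).Qh, (D.net i).energy (p i - r) ≤ ρ) →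
      ∀ i, ‖p i - P i‖ ≤ C * ρ := by
  -- `B` depends on the medium alone, so it may be fixed before the discretisation.
  obtain ⟨B, hB0, hB⟩ : ∃ B : ℝ, 0 ≤ B ∧ ∀ j i, ‖mulL2 (hm.ξ_memLp j i)‖ ≤ B := by
    refine ⟨∑ j, ∑ i, ‖mulL2 (hm.ξ_memLp j i)‖, by positivity, fun j i => ?_⟩
    refine (Finset.single_le_sum (f := fun i => ‖mulL2 (hm.ξ_memLp j i)‖)
      (fun _ _ => norm_nonneg _) (Finset.mem_univ i)).trans ?_
    exact Finset.single_le_sum (f := fun j => ∑ i, ‖mulL2 (hm.ξ_memLp j i)‖)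
      (fun _ _ => Finset.sum_nonneg fun _ _ => norm_nonneg _) (Finset.mem_univ j)
  set C1 : ℝ := N * (N * (B * (2 * cStab)) * cStab + cStab) with hC1
  have hC1' : 0 ≤ C1 := by positivity
  refine ⟨cStab + cStab * (cStab * C1), by positivity, ?_⟩
  intro D ku kp β cApp h hD ρ p P hρ hp hP hproj happ
  choose r hr hρ' using happ
  have hrW : ∀ i, r i ∈ (D.net i).W := fun i => (D.net i).Qh_le (hr i)
  have hPW : ∀ i, P i ∈ (D.net i).W := fun i => (D.net i).Qh_le (hP i)
  have he : ∀ i, (P - r) i ∈ (D.net i).Qh := fun i => (D.net i).Qh.sub_mem (hP i) (hr i)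
  have heW : ∀ i, (P - r) i ∈ (D.net i).W := fun i => (D.net i).Qh_le (he i)
  have hwW : ∀ i, (p - r) i ∈ (D.net i).W := fun i => (D.net i).W.sub_mem (hp i) (hrW i)
  have hkey : D.aForm (P - r) (P - r) = D.aForm (p - r) (P - r) := by
    rw [Discretization.aForm_sub hm hPW hrW heW, Discretization.aForm_sub hm hp hrW heW,
      hproj _ he]
  set E := Real.sqrt (∑ i, (D.net i).energy ((P - r) i) ^ 2) with hE
  have hE0 : 0 ≤ E := Real.sqrt_nonneg _
  have hEsq : E ^ 2 = ∑ i, (D.net i).energy ((P - r) i) ^ 2 :=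
    Real.sq_sqrt (Finset.sum_nonneg fun i _ => sq_nonneg _)
  have heE : ∀ i, (D.net i).energy ((P - r) i) ≤ E := by
    intro i
    refine Real.le_sqrt_of_sq_le ?_
    exact Finset.single_le_sum (f := fun i => (D.net i).energy ((P - r) i) ^ 2)
      (fun _ _ => sq_nonneg _) (Finset.mem_univ i)
  have hen : ∀ i, ‖(P - r) i‖ ≤ cStab * E := fun i =>
    ((hD.net_adm i).poincare _ (heW i)).trans (mul_le_mul_of_nonneg_left (heE i) hc.le)
  have hwn : ∀ i, ‖(p - r) i‖ ≤ cStab * ρ := fun i =>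
    ((hD.net_adm i).poincare _ (hwW i)).trans (mul_le_mul_of_nonneg_left (hρ' i) hc.le)
  have hbd : D.aForm (p - r) (P - r) ≤ C1 * ρ * E := by
    have hi : ∀ i ∈ (Finset.univ : Finset (Fin N)),
        transferForm m.ξ i (p - r) ((P - r) i) + (D.net i).a ((p - r) i) ((P - r) i)
          ≤ (N * (B * (2 * cStab)) * cStab + cStab) * ρ * E := by
      intro i _
      have h1 : transferForm m.ξ i (p - r) ((P - r) i)
          ≤ (N * (B * (2 * (cStab * ρ)))) * (cStab * E) := by
        rw [transferForm_eq_inner hm.ξ_memLp]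
        refine (real_inner_le_norm _ _).trans ?_
        exact mul_le_mul (norm_transferL2_le hm.ξ_memLp i (fun j => hB j i) hwn) (hen i)
          (norm_nonneg _) (by positivity)
      have h2 : (D.net i).a ((p - r) i) ((P - r) i) ≤ cStab * ρ * E := by
        refine (le_abs_self _).trans (((hD.net_adm i).bounded _ (hwW i) _ (he i)).trans ?_)
        exact mul_le_mul (mul_le_mul_of_nonneg_left (hρ' i) hc.le) (heE i)
          ((D.net i).energy_nonneg _ (heW i)) (by positivity)
      linarith
    refine (Finset.sum_le_sum hi).trans (le_of_eq ?_)
    rw [Finset.sum_const, Finset.card_univ, Fintype.card_fin, nsmul_eq_mul, hC1]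
    ring
  have hE2 : E ≤ cStab * C1 * ρ := by
    have h1 := Discretization.sum_energy_sq_le hm hc.le hD he
    rw [← hEsq, hkey] at h1
    have h2 := mul_le_mul_of_nonneg_left hbd hc.le
    -- The estimate is `E² ≤ cStab C1 ρ E`; one factor `E` cancels unless it vanishes.
    rcases hE0.eq_or_lt with h0 | h0
    · rw [← h0]; positivity
    · refine le_of_mul_le_mul_right ?_ h0
      linarith
  intro i
  have h3 : p i - P i = (p - r) i - (P - r) i := by simp
  rw [h3]
  refine (norm_sub_le _ _).trans ((add_le_add (hwn i) (hen i)).trans ?_)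
  have := mul_le_mul_of_nonneg_left hE2 hc.le
  linarith

end aForm

/-! ### The Lamé projection -/

section lame

variable {d N : ℕ} {m : Medium d N} {cLam β : ℝ}

lemma inv_le_of_le_mul {μ cLam lam : ℝ} (hμ : 0 < μ) (hlam : 0 < lam) (h : μ ≤ cLam * lam) :
    lam⁻¹ ≤ cLam / μ := by
  rw [inv_eq_one_div, div_le_div_iff₀ hlam hμ]
  linarith

set_option maxHeartbeats 800000 in
-- Saddle point quasi-optimality, uniform in `λ`. Testing the projection equations with the
-- projection minus the competitor `(v, q)` gives the energy inequality of `exists_saddle_bound`;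
-- inf-sup applied to the first equation gives the other one.
lemma exists_lame_projection_bound (hμ : 0 < m.μ) (hcLam : 0 < cLam) (hβ : 0 < β) :
    ∃ C : ℝ, 0 < C ∧ ∀ (D : Discretization m) (ku kp : ℕ) (cStab cApp h lam : ℝ),
      D.Admissible ku kp β cStab cApp h → 0 < lam → m.μ ≤ cLam * lam →
      ∀ (X P : State m), D.IsProjection lam X P → ∀ (v : Fin d → H1 m.Ω) (q : L2 m.Ω) (r t : ℝ),
      v ∈ D.Vh → q ∈ D.Qth → vNorm m.μ (X.u - v) ≤ r → ‖X.pt - q‖ ≤ t →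
      vNorm m.μ (X.u - P.u) ≤ C * (r + t) ∧ ‖X.pt - P.pt‖ ≤ C * (r + t) := by
  have hs : 0 < Real.sqrt (2 * m.μ) := Real.sqrt_pos.2 (by positivity)
  set κ := divConst d m.μ with hκ
  have hκ0 : 0 ≤ κ := divConst_nonneg _ _
  obtain ⟨C, hC, H⟩ := exists_saddle_bound (κ := κ) (b := β * (Real.sqrt (2 * m.μ))⁻¹)
    (Λ := cLam / m.μ) hκ0 (by positivity) (by positivity)
  refine ⟨C + 1, by positivity, ?_⟩
  intro D ku kp cStab cApp h lam hD hlam hcl X P hP v q r t hv hq hr ht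
  have hr0 : 0 ≤ r := (vNorm_nonneg _ _).trans hr
  have ht0 : 0 ≤ t := (norm_nonneg _).trans ht
  have hθu : P.u - v ∈ D.Vh := D.Vh.sub_mem hP.mem.u_mem hv
  have hθt : P.pt - q ∈ D.Qth := D.Qth.sub_mem hP.mem.pt_mem hq
  have eq1 : ∀ z ∈ D.Vh, inner ℝ (divg z) (P.pt - q) = elasticForm m.μ (P.u - v) z
      - elasticForm m.μ (X.u - v) z + inner ℝ (divg z) (X.pt - q) := by
    intro z hz
    have h1 := hP.lame₁ z hz
    rw [real_inner_comm, real_inner_comm (divg z) X.pt] at h1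
    rw [elasticForm_sub_left hμ.le, elasticForm_sub_left hμ.le, inner_sub_right, inner_sub_right]
    linarith
  have eq2 : inner ℝ (divg (P.u - v)) (P.pt - q) + lam⁻¹ * inner ℝ (P.pt - q) (P.pt - q)
      = inner ℝ (divg (X.u - v)) (P.pt - q) + lam⁻¹ * inner ℝ (X.pt - q) (P.pt - q) := by
    have h1 := hP.lame₂ _ hθt
    simp only [divg_sub, inner_sub_left]
    linarith
  have hl : 0 ≤ lam⁻¹ := by positivity
  have h1 : vNorm m.μ (P.u - v) ^ 2 + lam⁻¹ * ‖P.pt - q‖ ^ 2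
      ≤ r * vNorm m.μ (P.u - v) + κ * t * vNorm m.μ (P.u - v) + κ * r * ‖P.pt - q‖
        + lam⁻¹ * t * ‖P.pt - q‖ := by
    have e1 := eq1 _ hθu
    rw [elasticForm_self hμ.le] at e1
    rw [real_inner_self_eq_norm_sq] at eq2
    have b1 : elasticForm m.μ (X.u - v) (P.u - v) ≤ r * vNorm m.μ (P.u - v) :=
      (le_abs_self _).trans ((abs_elasticForm_le hμ.le _ _).trans
        (mul_le_mul_of_nonneg_right hr (vNorm_nonneg _ _)))
    have b2 : -inner ℝ (divg (P.u - v)) (X.pt - q) ≤ κ * t * vNorm m.μ (P.u - v) := by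
      refine (neg_le_abs _).trans ((abs_inner_divg_le hμ _ _).trans ?_)
      calc _ ≤ divConst d m.μ * vNorm m.μ (P.u - v) * t :=
            mul_le_mul_of_nonneg_left ht (mul_nonneg hκ0 (vNorm_nonneg _ _))
        _ = _ := by rw [← hκ]; ring
    have b3 : inner ℝ (divg (X.u - v)) (P.pt - q) ≤ κ * r * ‖P.pt - q‖ :=
      (le_abs_self _).trans ((abs_inner_divg_le hμ _ _).trans
        (mul_le_mul_of_nonneg_right (mul_le_mul_of_nonneg_left hr hκ0) (norm_nonneg _)))
    have b4 : lam⁻¹ * inner ℝ (X.pt - q) (P.pt - q) ≤ lam⁻¹ * t * ‖P.pt - q‖ := by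
      rw [mul_assoc]
      exact mul_le_mul_of_nonneg_left ((real_inner_le_norm _ _).trans
        (mul_le_mul_of_nonneg_right ht (norm_nonneg _))) hl
    linarith
  have h2 : β * (Real.sqrt (2 * m.μ))⁻¹ * ‖P.pt - q‖ ≤ vNorm m.μ (P.u - v) + r + κ * t := by
    refine hD.norm_le_of_inner_divg_le hθt
      (add_nonneg (add_nonneg (vNorm_nonneg _ _) hr0) (mul_nonneg hκ0 ht0)) fun z hz => ?_
    have hz0 := vNorm_nonneg m.μ z
    rw [eq1 z hz]
    have b1 : elasticForm m.μ (P.u - v) z ≤ vNorm m.μ (P.u - v) * vNorm m.μ z :=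
      (le_abs_self _).trans (abs_elasticForm_le hμ.le _ _)
    have b2 : -elasticForm m.μ (X.u - v) z ≤ r * vNorm m.μ z :=
      (neg_le_abs _).trans ((abs_elasticForm_le hμ.le _ _).trans
        (mul_le_mul_of_nonneg_right hr hz0))
    have b3 : inner ℝ (divg z) (X.pt - q) ≤ κ * vNorm m.μ z * t :=
      (le_abs_self _).trans ((abs_inner_divg_le hμ _ _).trans
        (mul_le_mul_of_nonneg_left ht (mul_nonneg hκ0 hz0)))
    linarith
  obtain ⟨k1, k2⟩ := H _ _ r t lam⁻¹ (vNorm_nonneg m.μ (P.u - v)) (norm_nonneg (P.pt - q)) hr0 ht0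
    hl (inv_le_of_le_mul hμ hlam hcl) h1 h2
  constructor
  · have : X.u - P.u = (X.u - v) - (P.u - v) := by abel
    rw [this]
    refine (vNorm_sub_le hμ.le _ _).trans ?_
    linarith
  · have : X.pt - P.pt = (X.pt - q) - (P.pt - q) := by abel
    rw [this]
    refine (norm_sub_le _ _).trans ?_
    linarith

end lame

/-! ### Projection errors of a regular state -/

section projection

variable {d N : ℕ} {m : Medium d N} {cLam β cStab cApp M : ℝ}

set_option maxHeartbeats 800000 in
lemma exists_projection_error_bound (hm : m.Admissible) (hcLam : 0 < cLam) (hβ : 0 < β)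
    (hcStab : 0 < cStab) (hcApp : 0 < cApp) (hM : 0 < M) :
    ∃ C : ℝ, 0 < C ∧ ∀ (D : Discretization m) (ku kp : ℕ) (h lam : ℝ), 0 < h →
      D.Admissible ku kp β cStab cApp h → 0 < lam → m.μ ≤ cLam * lam →
      ∀ (U : Fin d → H1 m.Ω) (q : L2 m.Ω) (w : Fin N → H1 m.Ω) (P : State m),
      U ∈ V m.Ω m.Γd → (∀ i, MemHm (ku + 1) (fn (U i))) →
      vecHmNorm (ku + 1) (fun i => fn (U i)) ≤ M → MemHm ku q → hmNorm ku q ≤ M →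
      (∀ i, w i ∈ H1zero m.Ω (frontier m.Ω)) → (∀ i, MemHm (kp + 1) (fn (w i))) →
      (∀ i, hmNorm (kp + 1) (fn (w i)) ≤ M) → (∀ i, fn (w i) ∈ (D.net i).W) →
      D.IsProjection lam ⟨U, q, fun i => fn (w i)⟩ P →
      vNorm m.μ (U - P.u) ≤ C * h ^ ku ∧ ‖q - P.pt‖ ≤ C * h ^ ku ∧
        ∀ i, ‖fn (w i) - P.p i‖ ≤ C * h ^ kp := by
  obtain ⟨C1, hC1, H1⟩ := exists_lame_projection_bound (m := m) hm.μ_pos hcLam hβ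
  obtain ⟨C2, hC2, H2⟩ := exists_elliptic_projection_bound (m := m) hm hcStab
  have hs : 0 < Real.sqrt (2 * m.μ) := Real.sqrt_pos.2 (by have := hm.μ_pos; positivity)
  refine ⟨C1 * (2 * cApp * M + Real.sqrt (2 * m.μ) * (2 * cApp * M)) + C2 * (2 * cApp * M),
    by positivity, ?_⟩
  intro D ku kp h lam hh hD hlam hcl U q w P hU hU1 hU2 hq1 hq2 hw hw1 hw2 hwW hP
  -- The factor `2` leaves strict room above the infimum, so a near-minimiser exists whether or not
  -- the infimum is attained.
  have hlt : ∀ (k : ℕ) (x : ℝ), x ≤ M → cApp * h ^ k * x < 2 * cApp * M * h ^ k := by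
    intro k x hx
    have h0 : 0 < cApp * h ^ k := by positivity
    have h1 := mul_le_mul_of_nonneg_left hx h0.le
    have h2 : 0 < cApp * h ^ k * M := by positivity
    linarith
  obtain ⟨v, hv⟩ := exists_lt_of_ciInf_lt ((hD.Vh_approx U hU hU1).trans_lt (hlt ku _ hU2))
  obtain ⟨r, hr⟩ := exists_lt_of_ciInf_lt ((hD.Qth_approx q hq1).trans_lt (hlt ku _ hq2))
  have hr' : ‖q - r.1‖ ≤ Real.sqrt (2 * m.μ) * (2 * cApp * M * h ^ ku) := by
    rw [norm_eq_qtNorm hm.μ_pos]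
    exact mul_le_mul_of_nonneg_left hr.le hs.le
  obtain ⟨a1, a2⟩ := H1 D ku kp cStab cApp h lam hD hlam hcl _ P hP v.1 r.1 _ _ v.2 r.2 hv.le hr'
  have a3 := H2 D ku kp β cApp h hD (2 * cApp * M * h ^ kp) _ P.p (by positivity) hwW hP.mem.p_mem
    hP.elliptic fun i => by
      obtain ⟨z, hz⟩ := exists_lt_of_ciInf_lt
        (((hD.net_adm i).approx (w i) (hw i) (hw1 i) (hwW i)).trans_lt (hlt kp _ (hw2 i)))
      exact ⟨z.1, z.2, hz.le⟩
  have b1 : 0 ≤ C2 * (2 * cApp * M) * h ^ ku := by positivity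
  have b2 : 0 ≤ C1 * (2 * cApp * M + Real.sqrt (2 * m.μ) * (2 * cApp * M)) * h ^ kp := by
    positivity
  refine ⟨a1.trans ?_, a2.trans ?_, fun i => (a3 i).trans ?_⟩ <;> linarith

end projection

/-! ### The energy identity of one step -/

section algebra

variable {H : Type*} [NormedAddCommGroup H] [InnerProductSpace ℝ H]

/-- The diffusion equation of one network: the mean of the exact equations at the two ends minus the
scheme, times `τ`. The sources cancel because the scheme averages them in the same way. Suffixes
`a`, `b` mark the ends of the step, and `k` stands for `α_i λ⁻¹`. -/
lemma step_defect_identity {q g0 g1 pa pb ta tb Da Db Ta Tb Th δp δt δD : H}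
    {s k τ aa ab ah : ℝ}
    (h0 : aa = inner ℝ (g0 - (s • pa + k • (-ta + Da)) - Ta) q)
    (h1 : ab = inner ℝ (g1 - (s • pb + k • (-tb + Db)) - Tb) q)
    (hstep : -inner ℝ (s • δp) q - (inner ℝ (k • (-δt + δD)) q + inner ℝ Th q) - ah
      = -inner ℝ ((1 / 2 : ℝ) • (g0 + g1)) q) :
    inner ℝ (s • ((τ / 2) • (pa + pb) - τ • δp) + k • (-((τ / 2) • (ta + tb) - τ • δt)
      + ((τ / 2) • (Da + Db) - τ • δD))) q
      + ((τ / 2) * (inner ℝ Ta q + aa + (inner ℝ Tb q + ab)) - τ * (inner ℝ Th q + ah)) = 0 := by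
  simp only [inner_add_left, inner_sub_left, inner_neg_left, real_inner_smul_left] at h0 h1 hstep ⊢
  linear_combination (τ / 2) * h0 + (τ / 2) * h1 + τ * hstep

/-- In the application `t = e_t`, `r = α·e_p`, `x = ‖e_u‖_V`, `l = λ⁻¹`, and `δ` dominates the
defects `a`, `c`. Adding the two identities completes the square `l ‖t - r‖²`. On the right, `‖t‖ ≤
x / b` and `‖r‖ ≤ ‖t‖ + ‖t - r‖` allow Young's inequality to absorb everything. -/
lemma exists_energy_bound {b Λ γ : ℝ} (hb : 0 < b) (hΛ : 0 ≤ Λ) (hγ : 0 ≤ γ) :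
    ∃ C : ℝ, 0 < C ∧ ∀ {H : Type} [NormedAddCommGroup H] [InnerProductSpace ℝ H]
      (t r a c : H) (x S A τ l δ G : ℝ), 0 ≤ x → 0 ≤ S → 0 ≤ A → 0 ≤ τ → 0 ≤ l → l ≤ Λ → 0 ≤ δ →
      b * ‖t‖ ≤ x → ‖a‖ ≤ δ → ‖c‖ ≤ δ → G ≤ 1 / 2 * S + γ * δ ^ 2 →
      x ^ 2 + l * ‖t‖ ^ 2 = l * inner ℝ r t + l * inner ℝ a t →
      S + l * ‖r‖ ^ 2 - l * inner ℝ t r + τ / 2 * A = G + l * inner ℝ c r →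
      x ^ 2 ≤ C * δ ^ 2 ∧ ‖t‖ ^ 2 ≤ C * δ ^ 2 ∧ S + l * ‖r‖ ^ 2 ≤ C * δ ^ 2 ∧
        τ * A ≤ C * δ ^ 2 := by
  set K := γ + Λ / 2 + 2 * (Λ / b) ^ 2 with hK
  have hK0 : 0 ≤ K := by positivity
  refine ⟨6 * K + 2 * K / b ^ 2 + 4 * Λ * (K / b ^ 2) + 1, by positivity, ?_⟩
  intro H _ _ t r a c x S A τ l δ G hx hS hA hτ hl hlΛ hδ hbt ha hc hG h1 h2
  have hn : ‖t - r‖ ^ 2 = ‖t‖ ^ 2 - 2 * inner ℝ t r + ‖r‖ ^ 2 := norm_sub_sq_real t r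
  have hr : ‖r‖ ≤ ‖t‖ + ‖t - r‖ := by
    have : r = t - (t - r) := by abel
    calc ‖r‖ = ‖t - (t - r)‖ := by rw [← this]
      _ ≤ _ := norm_sub_le _ _
  rw [real_inner_comm] at h1
  set y := ‖t‖
  set n := ‖t - r‖
  have hy : 0 ≤ y := norm_nonneg _
  have hn0 : 0 ≤ n := norm_nonneg _
  have b1 : inner ℝ a t ≤ δ * y :=
    (real_inner_le_norm _ _).trans (mul_le_mul_of_nonneg_right ha hy)
  have b2 : inner ℝ c r ≤ δ * (y + n) :=
    (real_inner_le_norm _ _).trans (mul_le_mul hc hr (norm_nonneg _) hδ)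
  have b3 := mul_le_mul_of_nonneg_left b1 hl
  have b4 := mul_le_mul_of_nonneg_left b2 hl
  have hyx : y ≤ x / b := by rw [le_div_iff₀ hb]; linarith
  have b5 : l * (δ * n) ≤ l * (n ^ 2 / 2) + Λ / 2 * δ ^ 2 := by
    have e1 : l * (δ * n) ≤ l * (n ^ 2 / 2 + δ ^ 2 / 2) :=
      mul_le_mul_of_nonneg_left (by nlinarith [sq_nonneg (δ - n)]) hl
    have e2 : l * (δ ^ 2 / 2) ≤ Λ * (δ ^ 2 / 2) := mul_le_mul_of_nonneg_right hlΛ (by positivity)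
    linarith
  have b6 : 2 * (l * (δ * y)) ≤ 1 / 2 * x ^ 2 + 2 * (Λ / b) ^ 2 * δ ^ 2 := by
    have e1 : l * (δ * y) ≤ Λ * (δ * (x / b)) :=
      mul_le_mul hlΛ (mul_le_mul_of_nonneg_left hyx hδ) (by positivity) hΛ
    have e2 : Λ * (δ * (x / b)) = (Λ / b * δ) * x := by ring
    have e3 : 2 * ((Λ / b * δ) * x) ≤ 1 / 2 * x ^ 2 + 2 * (Λ / b * δ) ^ 2 := by
      linarith [sq_nonneg (x - 2 * (Λ / b * δ)), sub_sq x (2 * (Λ / b * δ))]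
    rw [mul_pow] at e3
    linarith
  have hln : l * n ^ 2 = l * (y ^ 2 - 2 * inner ℝ t r + ‖r‖ ^ 2) := by rw [hn]
  have hln0 : 0 ≤ l * n ^ 2 := by positivity
  have hA0 : 0 ≤ τ * A := by positivity
  -- Half of `x²`, of `l n²` and of `S` has been absorbed; doubling what remains gives this.
  have main : x ^ 2 + l * n ^ 2 + S + τ * A ≤ 2 * K * δ ^ 2 := by
    rw [hK]
    linarith
  have hx2 : x ^ 2 ≤ 2 * K * δ ^ 2 := by linarith
  have hy2 : y ^ 2 ≤ 2 * (K / b ^ 2) * δ ^ 2 := by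
    have e1 : y ^ 2 ≤ (x / b) ^ 2 := pow_le_pow_left₀ hy hyx 2
    have e2 : (x / b) ^ 2 ≤ 2 * K * δ ^ 2 / b ^ 2 := by
      rw [div_pow]
      exact div_le_div_of_nonneg_right hx2 (by positivity)
    calc y ^ 2 ≤ _ := e1.trans e2
      _ = _ := by ring
  have hr2 : l * ‖r‖ ^ 2 ≤ 2 * (l * y ^ 2) + 2 * (l * n ^ 2) := by
    have e1 : ‖r‖ ^ 2 ≤ 2 * y ^ 2 + 2 * n ^ 2 := by
      have := pow_le_pow_left₀ (norm_nonneg r) hr 2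
      nlinarith [sq_nonneg (y - n)]
    have := mul_le_mul_of_nonneg_left e1 hl
    linarith
  have hly : l * y ^ 2 ≤ Λ * (2 * (K / b ^ 2) * δ ^ 2) :=
    mul_le_mul hlΛ hy2 (by positivity) hΛ
  have p1 : 0 ≤ K * δ ^ 2 := by positivity
  have p2 : 0 ≤ K / b ^ 2 * δ ^ 2 := by positivity
  have p3 : 0 ≤ Λ * (K / b ^ 2) * δ ^ 2 := by positivity
  have p4 : 0 ≤ δ ^ 2 := by positivity
  have hexp : (6 * K + 2 * K / b ^ 2 + 4 * Λ * (K / b ^ 2) + 1) * δ ^ 2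
      = 6 * (K * δ ^ 2) + 2 * (K / b ^ 2 * δ ^ 2) + 4 * (Λ * (K / b ^ 2) * δ ^ 2) + δ ^ 2 := by
    ring
  rw [hexp]
  refine ⟨?_, ?_, ?_, ?_⟩ <;> linarith [sq_nonneg x]

end algebra

/-! ### The combination `α·p` and storage-weighted sums -/

section dot

variable {d N : ℕ} {Ω : Set (Pt d)} {α : Fin N → ℝ}

lemma dotα_add (p q : Fin N → L2 Ω) : dotα α (p + q) = dotα α p + dotα α q := by
  simp [dotα, Finset.sum_add_distrib]

lemma dotα_sub (p q : Fin N → L2 Ω) : dotα α (p - q) = dotα α p - dotα α q := by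
  simp [dotα, smul_sub, Finset.sum_sub_distrib]

lemma dotα_smul (c : ℝ) (p : Fin N → L2 Ω) : dotα α (c • p) = c • dotα α p := by
  simp [dotα, Finset.smul_sum, smul_comm c]

lemma norm_dotα_le (hα : ∀ i, α i ∈ Ioc (0 : ℝ) 1) {p : Fin N → L2 Ω} {c : ℝ}
    (hp : ∀ i, ‖p i‖ ≤ c) : ‖dotα α p‖ ≤ N * c := by
  refine (norm_sum_le _ _).trans ?_
  have : ∀ i ∈ (Finset.univ : Finset (Fin N)), ‖α i • p i‖ ≤ c := by
    intro i _
    rw [norm_smul, Real.norm_of_nonneg (hα i).1.le]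
    exact (mul_le_of_le_one_left (norm_nonneg _) (hα i).2).trans (hp i)
  exact (Finset.sum_le_sum this).trans (by simp)

/-- Summation over the networks collapses the coupling through `α_i z` to one inner product with
`α·e`, the quantity that also appears in the total pressure equation. -/
lemma sum_inner_smul_dotα (s : Fin N → ℝ) (l : ℝ) (w e : Fin N → L2 Ω) (z : L2 Ω) :
    ∑ i, inner ℝ (s i • w i + (α i * l) • z) (e i)
      = (∑ i, s i * inner ℝ (w i) (e i)) + l * inner ℝ z (dotα α e) := by
  simp only [dotα, inner_sum, Finset.mul_sum, ← Finset.sum_add_distrib, inner_add_left,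
    real_inner_smul_left, real_inner_smul_right]
  refine Finset.sum_congr rfl fun i _ => ?_
  ring

/-- Young's inequality with the weight `s_i` kept on the error, where the energy absorbs it, and
replaced by `sMax` on the defect. No lower bound on `s_i` enters the constant. -/
lemma neg_sum_mul_inner_le {s : Fin N → ℝ} {sMax c : ℝ} (hs : ∀ i, 0 < s i ∧ s i ≤ sMax)
    {w e : Fin N → L2 Ω} (hw : ∀ i, ‖w i‖ ≤ c) :
    -∑ i, s i * inner ℝ (w i) (e i)
      ≤ 1 / 2 * ∑ i, s i * ‖e i‖ ^ 2 + 1 / 2 * N * sMax * c ^ 2 := by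
  have hi : ∀ i ∈ (Finset.univ : Finset (Fin N)), -(s i * inner ℝ (w i) (e i))
      ≤ 1 / 2 * (s i * ‖e i‖ ^ 2) + 1 / 2 * (sMax * c ^ 2) := by
    intro i _
    have h1 : -inner ℝ (w i) (e i) ≤ ‖w i‖ * ‖e i‖ :=
      (neg_le_abs _).trans (abs_real_inner_le_norm _ _)
    have h2 : -inner ℝ (w i) (e i) ≤ 1 / 2 * ‖e i‖ ^ 2 + 1 / 2 * ‖w i‖ ^ 2 := by
      nlinarith [sq_nonneg (‖w i‖ - ‖e i‖)]
    have h3 := mul_le_mul_of_nonneg_left h2 (hs i).1.le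
    have h4 : s i * ‖w i‖ ^ 2 ≤ sMax * c ^ 2 :=
      mul_le_mul (hs i).2 (pow_le_pow_left₀ (norm_nonneg _) (hw i) 2) (by positivity)
        ((hs i).1.le.trans (hs i).2)
    linarith
  rw [← Finset.sum_neg_distrib]
  refine (Finset.sum_le_sum hi).trans (le_of_eq ?_)
  rw [Finset.sum_add_distrib, ← Finset.mul_sum, Finset.sum_const, Finset.card_univ,
    Fintype.card_fin, nsmul_eq_mul]
  ring

end dot

/-! ### Error equations of the step -/

section step

variable {d N : ℕ} {m : Medium d N} {D : Discretization m} {s : Fin N → ℝ} {lam T M τ : ℝ}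
  {ku kp : ℕ} {β cStab cApp h : ℝ}
  {f : ℝ → Fin d → L2 m.Ω} {g : ℝ → Fin N → L2 m.Ω}
  {u0 : Fin d → H1 m.Ω} {pt0 : L2 m.Ω} {p0 : Fin N → H1 m.Ω}
  {u : ℝ → Fin d → H1 m.Ω} {pt : ℝ → L2 m.Ω} {p : ℝ → Fin N → H1 m.Ω}
  {P0 P1 X0h X1h : State m}

lemma Discretization.aForm_add (hm : m.Admissible) {p q r : Fin N → L2 m.Ω}
    (hp : ∀ i, p i ∈ (D.net i).W) (hq : ∀ i, q i ∈ (D.net i).W) (hr : ∀ i, r i ∈ (D.net i).W) :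
    D.aForm (p + q) r = D.aForm p r + D.aForm q r := by
  have h : p + q = p - (-1 : ℝ) • q := by module
  rw [h, Discretization.aForm_sub (q := (-1 : ℝ) • q) hm hp (fun i => (D.net i).W.smul_mem _ (hq i)) hr,
    Discretization.aForm_smul hm _ hq hr]
  ring

/-- The trapezoidal approximation of the increment of `q` over `[0, τ]`. -/
def trapezoid {Ω : Set (Pt d)} (T τ : ℝ) (q : ℝ → L2 Ω) : L2 Ω := (τ / 2) • (dt T q 0 + dt T q τ)

/-- The body force cancels because `V_h ⊆ V`. The Lamé projection ignores `α·p`, so its elliptic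
projection error is the only defect. -/
lemma stokes_energy_identity (hm : m.Admissible) (hD : D.Admissible ku kp β cStab cApp h)
    (hτ : 0 < τ) (hτT : τ ≤ T) (hs : IsSolution m s lam T f g u0 pt0 p0 u pt p)
    (hP1 : D.IsProjection lam (stateAt u pt p τ) P1) {g0 g1 : Fin N → L2 m.Ω}
    (hX : D.IsMonolithicStep s lam τ (f τ) g0 g1 X0h X1h) :
    (∀ v ∈ D.Vh, inner ℝ (divg v) (P1.pt - X1h.pt) = elasticForm m.μ (P1.u - X1h.u) v) ∧
    vNorm m.μ (P1.u - X1h.u) ^ 2 + lam⁻¹ * ‖P1.pt - X1h.pt‖ ^ 2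
      = lam⁻¹ * inner ℝ (dotα m.α (P1.p - X1h.p)) (P1.pt - X1h.pt)
        + lam⁻¹ * inner ℝ (dotα m.α ((fun i => fn (p τ i)) - P1.p)) (P1.pt - X1h.pt) := by
  have hμ := hm.μ_pos
  obtain ⟨e1, e2⟩ := hs.stokes τ ⟨hτ, hτT⟩
  have hdu : P1.u - X1h.u ∈ D.Vh := D.Vh.sub_mem hP1.mem.u_mem hX.mem.u_mem
  have hdt : P1.pt - X1h.pt ∈ D.Qth := D.Qth.sub_mem hP1.mem.pt_mem hX.mem.pt_mem
  have k1 : ∀ v ∈ D.Vh, inner ℝ (divg v) (P1.pt - X1h.pt)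
      = elasticForm m.μ (P1.u - X1h.u) v := by
    intro v hv
    have a1 : elasticForm m.μ P1.u v - inner ℝ P1.pt (divg v)
      = elasticForm m.μ (u τ) v - inner ℝ (pt τ) (divg v) := hP1.lame₁ v hv
    have a2 := hX.elasticity v hv
    have a3 := e1 v (hD.Vh_le hv)
    rw [elasticForm_sub_left hμ.le, real_inner_comm, inner_sub_left]
    linarith
  refine ⟨k1, ?_⟩
  have a1 : -inner ℝ (divg P1.u) (P1.pt - X1h.pt) - lam⁻¹ * inner ℝ P1.pt (P1.pt - X1h.pt)
      = -inner ℝ (divg (u τ)) (P1.pt - X1h.pt) - lam⁻¹ * inner ℝ (pt τ) (P1.pt - X1h.pt) :=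
    hP1.lame₂ _ hdt
  have a2 := hX.totalPressure _ hdt
  have a3 := e2 (P1.pt - X1h.pt)
  have a4 := k1 _ hdu
  rw [elasticForm_self hμ.le] at a4
  have c1 : inner ℝ (divg (P1.u - X1h.u)) (P1.pt - X1h.pt)
      = inner ℝ (divg P1.u) (P1.pt - X1h.pt) - inner ℝ (divg X1h.u) (P1.pt - X1h.pt) := by
    rw [divg_sub]
    exact inner_sub_left _ _ _
  have c2 : ‖P1.pt - X1h.pt‖ ^ 2
      = inner ℝ P1.pt (P1.pt - X1h.pt) - inner ℝ X1h.pt (P1.pt - X1h.pt) := by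
    rw [← real_inner_self_eq_norm_sq]
    exact inner_sub_left _ _ _
  have c3 : ∀ p q : Fin N → L2 m.Ω, inner ℝ (dotα m.α (p - q)) (P1.pt - X1h.pt)
      = inner ℝ (dotα m.α p) (P1.pt - X1h.pt) - inner ℝ (dotα m.α q) (P1.pt - X1h.pt) := by
    intro p q
    rw [dotα_sub]
    exact inner_sub_left _ _ _
  rw [c2, c3, c3]
  linarith

lemma pressure_energy_identity (hm : m.Admissible) (hD : D.Admissible ku kp β cStab cApp h)
    (hτ : 0 < τ) (hτT : τ ≤ T) (hg : ContinuousOn g (Icc 0 T))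
    (hs : IsSolution m s lam T f g u0 pt0 p0 u pt p) (hr : IsRegular ku kp T M u pt p)
    (hP0 : D.IsProjection lam (stateAt u pt p 0) P0)
    (hP1 : D.IsProjection lam (stateAt u pt p τ) P1) (hp : X0h.p = P0.p) {f1 : Fin d → L2 m.Ω}
    (hX : D.IsMonolithicStep s lam τ f1 (g 0) (g τ) X0h X1h) {w : Fin N → L2 m.Ω}
    (hw : w = fun i => trapezoid T τ (fun t => fn (p t i)) - (X1h.p i - X0h.p i)) {wt : L2 m.Ω}
    (hwt : wt = trapezoid T τ pt - (X1h.pt - X0h.pt)) :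
    (∑ i, s i * inner ℝ (w i) ((P1.p - X1h.p) i))
      + lam⁻¹ * inner ℝ (-wt + dotα m.α w) (dotα m.α (P1.p - X1h.p))
      + τ / 2 * D.aForm (P1.p - X1h.p) (P1.p - X1h.p) = 0 := by
  have hT : 0 < T := hτ.trans_le hτT
  have hc0 := fun i => hs.discrete_consistency hm hT hg hr hD i (t := 0) ⟨le_rfl, hT.le⟩
  have hc1 := fun i => hs.discrete_consistency hm hT hg hr hD i (t := τ) ⟨hτ.le, hτT⟩
  set ep := P1.p - X1h.p with hep
  have he : ∀ i, ep i ∈ (D.net i).Qh := fun i =>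
    (D.net i).Qh.sub_mem (hP1.mem.p_mem i) (hX.mem.p_mem i)
  have heW : ∀ i, ep i ∈ (D.net i).W := fun i => (D.net i).Qh_le (he i)
  have hX0 : ∀ i, X0h.p i ∈ (D.net i).W := fun i => by
    rw [hp]; exact (D.net i).Qh_le (hP0.mem.p_mem i)
  have hX1 : ∀ i, X1h.p i ∈ (D.net i).W := fun i => (D.net i).Qh_le (hX.mem.p_mem i)
  have hP1W : ∀ i, P1.p i ∈ (D.net i).W := fun i => (D.net i).Qh_le (hP1.mem.p_mem i)
  have hmid : ∀ i, (X0h.p + X1h.p) i ∈ (D.net i).W := fun i => (D.net i).W.add_mem (hX0 i) (hX1 i)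
  have hdw : dotα m.α w = ((τ / 2) • (dotα m.α (fun k => dt T (fun t => fn (p t k)) 0)
      + dotα m.α (fun k => dt T (fun t => fn (p t k)) τ)))
      - τ • dotα m.α (τ⁻¹ • (X1h.p - X0h.p)) := by
    have h1 : w = (τ / 2) • ((fun k => dt T (fun t => fn (p t k)) 0)
      + (fun k => dt T (fun t => fn (p t k)) τ)) - (X1h.p - X0h.p) := hw
    rw [h1, dotα_sub, dotα_smul, dotα_add, dotα_smul, smul_inv_smul₀ hτ.ne']
  have hcomp : ∀ i, inner ℝ (s i • w i + (m.α i * lam⁻¹) • (-wt + dotα m.α w)) (ep i)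
      + ((τ / 2) * ((transferForm m.ξ i (fun k => fn (p 0 k)) (ep i)
          + (D.net i).a (fn (p 0 i)) (ep i)) + (transferForm m.ξ i (fun k => fn (p τ k)) (ep i)
          + (D.net i).a (fn (p τ i)) (ep i)))
        - τ * (transferForm m.ξ i ((1 / 2 : ℝ) • (X0h.p + X1h.p)) (ep i)
          + (D.net i).a ((1 / 2 : ℝ) • (X0h.p i + X1h.p i)) (ep i))) = 0 := by
    intro i
    have h3 := hX.diffusion i (ep i) (he i)
    rw [transferForm_eq_inner hm.ξ_memLp] at h3
    have h4 := step_defect_identity (τ := τ) ((hc0 i).2 (ep i) (he i))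
      ((hc1 i).2 (ep i) (he i)) h3
    rw [← hdw, smul_inv_smul₀ hτ.ne', smul_inv_smul₀ hτ.ne'] at h4
    simp only [transferForm_eq_inner hm.ξ_memLp]
    rw [hwt]
    subst hw
    exact h4
  have hsum := Finset.sum_congr rfl (s₁ := (Finset.univ : Finset (Fin N))) fun i _ => hcomp i
  rw [Finset.sum_add_distrib, Finset.sum_sub_distrib, ← Finset.mul_sum, ← Finset.mul_sum,
    Finset.sum_add_distrib, sum_inner_smul_dotα, Finset.sum_const_zero] at hsum
  have q0 : D.aForm P0.p ep = ∑ i, (transferForm m.ξ i (fun k => fn (p 0 k)) (ep i)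
      + (D.net i).a (fn (p 0 i)) (ep i)) := hP0.elliptic ep he
  have q1 : D.aForm P1.p ep = ∑ i, (transferForm m.ξ i (fun k => fn (p τ k)) (ep i)
      + (D.net i).a (fn (p τ i)) (ep i)) := hP1.elliptic ep he
  have q2 : D.aForm ((1 / 2 : ℝ) • (X0h.p + X1h.p)) ep
      = ∑ i, (transferForm m.ξ i ((1 / 2 : ℝ) • (X0h.p + X1h.p)) (ep i)
          + (D.net i).a ((1 / 2 : ℝ) • (X0h.p i + X1h.p i)) (ep i)) := rfl
  -- With `p_h^0 = Πp^0` the contributions of time `0` to `A` cancel; half of the new error remains,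
  -- which explains the factor `τ / 2`.
  rw [← q0, ← q1, ← q2, Discretization.aForm_smul hm _ hmid heW,
    Discretization.aForm_add hm hX0 hX1 heW, hp] at hsum
  have q3 : D.aForm ep ep = D.aForm P1.p ep - D.aForm X1h.p ep :=
    Discretization.aForm_sub hm hP1W hX1 heW
  rw [q3]
  linarith

end step

/-! ### Bounds for the discrete errors -/

section bounds

variable {d N : ℕ} {m : Medium d N} {D : Discretization m} {s : Fin N → ℝ} {lam T M τ : ℝ}
  {ku kp : ℕ} {β cStab cApp h : ℝ}
  {f : ℝ → Fin d → L2 m.Ω} {g : ℝ → Fin N → L2 m.Ω}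
  {u0 : Fin d → H1 m.Ω} {pt0 : L2 m.Ω} {p0 : Fin N → H1 m.Ω}
  {u : ℝ → Fin d → H1 m.Ω} {pt : ℝ → L2 m.Ω} {p : ℝ → Fin N → H1 m.Ω}
  {P0 P1 X0h X1h : State m}

/-- Each increment defect splits into a discrete error at the new time and a known part, `θ` or `ψ`.
The old pressure error vanishes, whereas the old total pressure error need not and stays inside `ψ`.
-/
lemma energy_balance (hm : m.Admissible) (hD : D.Admissible ku kp β cStab cApp h)
    (hτ : 0 < τ) (hτT : τ ≤ T) (hg : ContinuousOn g (Icc 0 T))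
    (hs : IsSolution m s lam T f g u0 pt0 p0 u pt p) (hr : IsRegular ku kp T M u pt p)
    (hP0 : D.IsProjection lam (stateAt u pt p 0) P0)
    (hP1 : D.IsProjection lam (stateAt u pt p τ) P1) (hp : X0h.p = P0.p) {f1 : Fin d → L2 m.Ω}
    (hX : D.IsMonolithicStep s lam τ f1 (g 0) (g τ) X0h X1h) {θ : Fin N → L2 m.Ω}
    (hθ : θ = fun i => trapezoid T τ (fun t => fn (p t i)) - (P1.p i - P0.p i)) {ψ : L2 m.Ω}
    (hψ : ψ = trapezoid T τ pt - (P1.pt - X0h.pt)) :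
    (∑ i, s i * ‖(P1.p - X1h.p) i‖ ^ 2) + lam⁻¹ * ‖dotα m.α (P1.p - X1h.p)‖ ^ 2
      - lam⁻¹ * inner ℝ (P1.pt - X1h.pt) (dotα m.α (P1.p - X1h.p))
      + τ / 2 * D.aForm (P1.p - X1h.p) (P1.p - X1h.p)
      = -(∑ i, s i * inner ℝ (θ i) ((P1.p - X1h.p) i))
        + lam⁻¹ * inner ℝ (ψ - dotα m.α θ) (dotα m.α (P1.p - X1h.p)) := by
  have hw : (fun i => trapezoid T τ (fun t => fn (p t i)) - (X1h.p i - X0h.p i))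
      = θ + (P1.p - X1h.p) := by
    rw [hθ, hp]
    funext i
    simp only [Pi.add_apply, Pi.sub_apply]
    abel
  have hwt : trapezoid T τ pt - (X1h.pt - X0h.pt) = ψ + (P1.pt - X1h.pt) := by
    rw [hψ]
    abel
  have key := pressure_energy_identity hm hD hτ hτT hg hs hr hP0 hP1 hp hX hw.symm hwt.symm
  rw [dotα_add] at key
  generalize P1.pt - X1h.pt = t at key ⊢
  generalize P1.p - X1h.p = ep at key ⊢
  have e1 : ∑ i, s i * inner ℝ ((θ + ep) i) (ep i)
      = (∑ i, s i * inner ℝ (θ i) (ep i)) + ∑ i, s i * ‖ep i‖ ^ 2 := by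
    rw [← Finset.sum_add_distrib]
    refine Finset.sum_congr rfl fun i _ => ?_
    rw [Pi.add_apply, inner_add_left, real_inner_self_eq_norm_sq, mul_add]
  have e2 : inner ℝ (-(ψ + t) + (dotα m.α θ + dotα m.α ep)) (dotα m.α ep)
      = -inner ℝ t (dotα m.α ep) + ‖dotα m.α ep‖ ^ 2
        - inner ℝ (ψ - dotα m.α θ) (dotα m.α ep) := by
    rw [← real_inner_self_eq_norm_sq]
    simp only [inner_add_left, inner_sub_left, inner_neg_left]
    ring
  rw [e1, e2] at key
  linarith

/-- The bounds for the discrete errors at both ends of the step, in terms of `η`. -/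
structure ErrorBounds (D : Discretization m) (s : Fin N → ℝ) (lam τ K K0 η : ℝ)
    (P0 P1 X0h X1h : State m) : Prop where
  u_old : vNorm m.μ (P0.u - X0h.u) ≤ K0 * η
  pt_old : qtNorm m.μ (P0.pt - X0h.pt) ≤ K0 * η
  u_new : vNorm m.μ (P1.u - X1h.u) ^ 2 ≤ K * η ^ 2
  pt_new : ‖P1.pt - X1h.pt‖ ^ 2 ≤ K * η ^ 2
  p_new : sNorm s m.α lam (P1.p - X1h.p) ^ 2 ≤ K * η ^ 2
  p_energy : τ * D.aNorm (P1.p - X1h.p) ^ 2 ≤ K * η ^ 2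

lemma sNorm_sq {α : Fin N → ℝ} {Ω : Set (Pt d)} (hs : ∀ i, 0 ≤ s i) (hlam : 0 ≤ lam)
    (q : Fin N → L2 Ω) :
    sNorm s α lam q ^ 2 = (∑ i, s i * ‖q i‖ ^ 2) + lam⁻¹ * ‖dotα α q‖ ^ 2 := by
  have h1 : sForm s α lam q q = (∑ i, s i * ‖q i‖ ^ 2) + lam⁻¹ * ‖dotα α q‖ ^ 2 := by
    simp only [sForm, real_inner_self_eq_norm_sq]
  rw [sNorm, h1, Real.sq_sqrt]
  exact add_nonneg (Finset.sum_nonneg fun i _ => mul_nonneg (hs i) (sq_nonneg _))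
    (mul_nonneg (inv_nonneg.2 hlam) (sq_nonneg _))

set_option maxHeartbeats 1600000 in
lemma exists_error_bounds (hm : m.Admissible) {sMax cLam cInit : ℝ} (T : ℝ) (ku kp : ℕ)
    (hsMax : 0 < sMax) (hcLam : 0 < cLam) (hβ : 0 < β) (hcStab : 0 < cStab) (hcApp : 0 < cApp)
    (hcInit : 0 < cInit) (hM : 0 < M) :
    ∃ K K0 : ℝ, 0 < K ∧ 0 < K0 ∧
      ∀ (s : Fin N → ℝ) (lam : ℝ), (∀ i, 0 < s i ∧ s i ≤ sMax) → 0 < lam → m.μ ≤ cLam * lam →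
      ∀ (f : ℝ → Fin d → L2 m.Ω) (g : ℝ → Fin N → L2 m.Ω), ContinuousOn g (Icc 0 T) →
      ∀ (u0 : Fin d → H1 m.Ω) (pt0 : L2 m.Ω) (p0 : Fin N → H1 m.Ω)
        (u : ℝ → Fin d → H1 m.Ω) (pt : ℝ → L2 m.Ω) (p : ℝ → Fin N → H1 m.Ω),
        IsSolution m s lam T f g u0 pt0 p0 u pt p → IsRegular ku kp T M u pt p →
      ∀ (h τ : ℝ), 0 < h → 0 < τ → τ ≤ T →
      ∀ D : Discretization m, D.Admissible ku kp β cStab cApp h →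
      ∀ P0 P1 X0h X1h : State m,
        D.IsProjection lam (stateAt u pt p 0) P0 → D.IsProjection lam (stateAt u pt p τ) P1 →
        D.IsInitial ku cInit h (stateAt u pt p 0) P0 X0h →
        D.IsMonolithicStep s lam τ (f τ) (g 0) (g τ) X0h X1h →
      ErrorBounds D s lam τ K K0 (τ ^ 3 + h ^ kp + h ^ ku) P0 P1 X0h X1h := by
  have hμ := hm.μ_pos
  have hσ : 0 < Real.sqrt (2 * m.μ) := Real.sqrt_pos.2 (by positivity)
  set σ := Real.sqrt (2 * m.μ) with hσdef
  obtain ⟨CP, hCP, HP⟩ :=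
    exists_projection_error_bound (m := m) hm hcLam hβ hcStab hcApp hM
  obtain ⟨CE, hCE, HE⟩ := exists_energy_bound (b := β * σ⁻¹) (Λ := cLam / m.μ)
    (γ := 1 / 2 * N * sMax) (by positivity) (by positivity) (by positivity)
  -- Old discrete errors: the projection error in the `V` and `Q_t` norms, plus the initial
  -- approximation error.
  set K0 := CP + σ⁻¹ * CP + cInit * (2 * M) with hK0
  have hK0' : 0 < K0 := by positivity
  -- `M` comes from the trapezoidal rule and `2 * CP` from projection errors at the two ends; `Cψ`
  -- adds the old total pressure error, with `σ` converting it to `L²`. `Cδ` is a common bound for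
  -- all defects.
  set Cθ := M + 2 * CP with hCθ
  set Cψ := M + 2 * CP + σ * K0 with hCψ
  set Cδ := N * CP + Cθ + Cψ + N * Cθ with hCδ
  have hNCP : 0 ≤ N * CP := by positivity
  have hCθ' : 0 < Cθ := by positivity
  have hNCθ : 0 ≤ N * Cθ := by positivity
  have hCψ' : 0 < Cψ := by positivity
  have hCδ' : 0 < Cδ := by positivity
  refine ⟨CE * Cδ ^ 2, K0, by positivity, hK0', ?_⟩
  intro s lam hs hlam hcl f g hg u0 pt0 p0 u pt p hsol hreg h τ hh hτ hτT D hD P0 P1 X0h X1h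
    hP0 hP1 hini hX
  have hT : 0 < T := hτ.trans_le hτT
  have hpu : 0 < h ^ ku := by positivity
  have hpp : 0 < h ^ kp := by positivity
  have hpτ : 0 < τ ^ 3 := by positivity
  set η := τ ^ 3 + h ^ kp + h ^ ku with hη
  have hη0 : 0 < η := by positivity
  have huη : h ^ ku ≤ η := by linarith
  have hpη : h ^ kp ≤ η := by linarith
  have hτη : τ ^ 3 ≤ η := by linarith
  have hproj : ∀ t ∈ Icc 0 T, ∀ P : State m, D.IsProjection lam (stateAt u pt p t) P →
      vNorm m.μ (u t - P.u) ≤ CP * η ∧ ‖pt t - P.pt‖ ≤ CP * η ∧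
        ∀ i, ‖fn (p t i) - P.p i‖ ≤ CP * η := by
    intro t ht P hP
    obtain ⟨a1, a2, a3⟩ := HP D ku kp h lam hh hD hlam hcl (u t) (pt t) (p t) P
      (hsol.u_mem t ht) (hreg.u_mem t ht) (hreg.u_le t ht) (hreg.pt_mem t ht) (hreg.pt_le t ht)
      (hsol.p_mem t ht) (hreg.p_mem t ht) (hreg.p_le t ht)
      (fun i => (hsol.discrete_consistency hm hT hg hreg hD i ht).1) hP
    have b1 := mul_le_mul_of_nonneg_left huη hCP.le
    have b2 := mul_le_mul_of_nonneg_left hpη hCP.le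
    exact ⟨a1.trans b1, a2.trans b1, fun i => (a3 i).trans b2⟩
  have h0T : (0 : ℝ) ∈ Icc 0 T := ⟨le_rfl, hT.le⟩
  obtain ⟨a1, a2, a3⟩ := hproj 0 h0T P0 hP0
  obtain ⟨-, b2, b3⟩ := hproj τ ⟨hτ.le, hτT⟩ P1 hP1
  have hinit : vNorm m.μ (u 0 - X0h.u) + qtNorm m.μ (pt 0 - X0h.pt) ≤ cInit * (2 * M) * η := by
    refine hini.bound.trans ?_
    have c1 : vecHmNorm (ku + 1) (fun i => fn ((stateAt u pt p 0).u i)) ≤ M := hreg.u_le 0 h0T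
    have c2 : hmNorm ku (stateAt u pt p 0).pt ≤ M := hreg.pt_le 0 h0T
    have c3 : vecHmNorm (ku + 1) (fun i => fn ((stateAt u pt p 0).u i))
      + hmNorm ku (stateAt u pt p 0).pt ≤ 2 * M := by linarith
    calc _ ≤ cInit * h ^ ku * (2 * M) := mul_le_mul_of_nonneg_left c3 (by positivity)
      _ = cInit * (2 * M) * h ^ ku := by ring
      _ ≤ _ := mul_le_mul_of_nonneg_left huη (by positivity)
  have hqt0 : 0 ≤ qtNorm m.μ (pt 0 - X0h.pt) := Real.sqrt_nonneg _
  have hvn0 := vNorm_nonneg m.μ (u 0 - X0h.u)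
  have hK0exp : K0 * η = CP * η + σ⁻¹ * CP * η + cInit * (2 * M) * η := by rw [hK0]; ring
  have hpos1 : 0 ≤ CP * η := by positivity
  have hpos2 : 0 ≤ σ⁻¹ * CP * η := by positivity
  have hu_old : vNorm m.μ (P0.u - X0h.u) ≤ K0 * η := by
    have e1 : P0.u - X0h.u = (u 0 - X0h.u) - (u 0 - P0.u) := by abel
    rw [e1]
    refine (vNorm_sub_le hμ.le _ _).trans ?_
    linarith
  have hpt_old' : ‖P0.pt - X0h.pt‖ ≤ σ * (K0 * η) := by
    have e1 : P0.pt - X0h.pt = (pt 0 - X0h.pt) - (pt 0 - P0.pt) := by abel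
    have e2 : ‖pt 0 - X0h.pt‖ ≤ σ * (cInit * (2 * M) * η) := by
      rw [norm_eq_qtNorm hμ]
      exact mul_le_mul_of_nonneg_left (by linarith) hσ.le
    have e3 : σ * (K0 * η) = σ * (CP * η) + CP * η + σ * (cInit * (2 * M) * η) := by
      rw [hK0exp]
      field_simp
    have e4 : 0 ≤ σ * (CP * η) := by positivity
    rw [e1]
    refine (norm_sub_le _ _).trans ?_
    linarith
  have hpt_old : qtNorm m.μ (P0.pt - X0h.pt) ≤ K0 * η := by
    rw [qtNorm_eq, inv_mul_le_iff₀ hσ]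
    exact hpt_old'
  have htr : ‖trapezoid T τ pt - (pt τ - pt 0)‖ ≤ M * τ ^ 3 :=
    norm_trapezoid_sub_le hτ hτT hreg.pt_smooth (hreg.pt_deriv_le 3 le_rfl)
  have htrp : ∀ i, ‖trapezoid T τ (fun t => fn (p t i)) - (fn (p τ i) - fn (p 0 i))‖
      ≤ M * τ ^ 3 := fun i =>
    norm_trapezoid_sub_le hτ hτT (hreg.p_smooth i) (hreg.p_deriv_le i 3 le_rfl)
  have hMτ := mul_le_mul_of_nonneg_left hτη hM.le
  obtain ⟨θ, hθ⟩ : ∃ θ : Fin N → L2 m.Ω,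
    θ = fun i => trapezoid T τ (fun t => fn (p t i)) - (P1.p i - P0.p i) := ⟨_, rfl⟩
  obtain ⟨ψ, hψ⟩ : ∃ ψ : L2 m.Ω, ψ = trapezoid T τ pt - (P1.pt - X0h.pt) := ⟨_, rfl⟩
  have hθn : ∀ i, ‖θ i‖ ≤ Cθ * η := by
    intro i
    have e1 : θ i = (trapezoid T τ (fun t => fn (p t i)) - (fn (p τ i) - fn (p 0 i)))
        + (fn (p τ i) - P1.p i) - (fn (p 0 i) - P0.p i) := by
      simp only [hθ]
      abel
    rw [e1]
    refine (norm_sub_le _ _).trans ((add_le_add_left (norm_add_le _ _) _).trans ?_)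
    rw [hCθ]
    linarith [htrp i, a3 i, b3 i]
  have hψn : ‖ψ‖ ≤ Cψ * η := by
    have e1 : ψ = (trapezoid T τ pt - (pt τ - pt 0)) + (pt τ - P1.pt) - (pt 0 - P0.pt)
        - (P0.pt - X0h.pt) := by
      rw [hψ]
      abel
    rw [e1]
    refine (norm_sub_le _ _).trans ((add_le_add_left (norm_sub_le _ _) _).trans
      ((add_le_add_left (add_le_add_left (norm_add_le _ _) _) _).trans ?_))
    rw [hCψ]
    linarith
  have hCδη : Cδ * η = N * CP * η + Cθ * η + Cψ * η + N * Cθ * η := by rw [hCδ]; ring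
  have q1 : 0 ≤ N * CP * η := mul_nonneg hNCP hη0.le
  have q2 : 0 ≤ Cθ * η := by positivity
  have q3 : 0 ≤ Cψ * η := by positivity
  have q4 : 0 ≤ N * Cθ * η := mul_nonneg hNCθ hη0.le
  have hθδ : ∀ i, ‖θ i‖ ≤ Cδ * η := fun i => (hθn i).trans (by linarith)
  have hcδ : ‖ψ - dotα m.α θ‖ ≤ Cδ * η := by
    have := norm_dotα_le hm.α_mem hθn
    refine (norm_sub_le _ _).trans ?_
    linarith
  have haδ : ‖dotα m.α ((fun i => fn (p τ i)) - P1.p)‖ ≤ Cδ * η := by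
    have := norm_dotα_le (p := (fun i => fn (p τ i)) - P1.p) hm.α_mem b3
    linarith
  obtain ⟨k1, k2⟩ := stokes_energy_identity hm hD hτ hτT hsol hP1 hX
  have k3 := energy_balance hm hD hτ hτT hg hsol hreg hP0 hP1 hini.p_eq hX hθ hψ
  have he : ∀ i, (P1.p - X1h.p) i ∈ (D.net i).Qh := fun i =>
    (D.net i).Qh.sub_mem (hP1.mem.p_mem i) (hX.mem.p_mem i)
  have hA := Discretization.aForm_self_nonneg hm hcStab hD he
  have hinf : β * σ⁻¹ * ‖P1.pt - X1h.pt‖ ≤ vNorm m.μ (P1.u - X1h.u) := by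
    refine hD.norm_le_of_inner_divg_le (D.Qth.sub_mem hP1.mem.pt_mem hX.mem.pt_mem)
      (vNorm_nonneg _ _) fun v hv => ?_
    rw [k1 v hv]
    exact (le_abs_self _).trans (abs_elasticForm_le hμ.le _ _)
  have hG := neg_sum_mul_inner_le hs (e := P1.p - X1h.p) hθδ
  obtain ⟨r1, r2, r3, r4⟩ := HE (P1.pt - X1h.pt) (dotα m.α (P1.p - X1h.p))
    (dotα m.α ((fun i => fn (p τ i)) - P1.p)) (ψ - dotα m.α θ) (vNorm m.μ (P1.u - X1h.u))
    (∑ i, s i * ‖(P1.p - X1h.p) i‖ ^ 2) (D.aForm (P1.p - X1h.p) (P1.p - X1h.p)) τ lam⁻¹ (Cδ * η)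
    (-(∑ i, s i * inner ℝ (θ i) ((P1.p - X1h.p) i))) (vNorm_nonneg _ _)
    (Finset.sum_nonneg fun i _ => mul_nonneg (hs i).1.le (sq_nonneg _)) hA hτ.le
    (inv_nonneg.2 hlam.le) (inv_le_of_le_mul hμ hlam hcl) (by positivity) hinf haδ hcδ hG k2 k3
  rw [mul_pow, ← mul_assoc] at r1 r2 r3 r4
  refine ⟨hu_old, hpt_old, r1, r2, ?_, ?_⟩
  · rw [sNorm_sq (fun i => (hs i).1.le) hlam.le]
    exact r3
  · rw [Discretization.aNorm, Real.sq_sqrt hA]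
    exact r4

end bounds

end MPET

end

/-! ### Assembly of the two estimates -/

theorem mainTheorem3 {d N : ℕ} (m : MPET.Medium d N) (hm : m.Admissible)
    (T : ℝ) (hT : 0 < T) (ku kp : ℕ) (hku : 1 ≤ ku) (hkp : 1 ≤ kp)
    (sMax cLam β cStab cApp cInit M : ℝ)
    (hsMax : 0 < sMax) (hcLam : 0 < cLam) (hβ : 0 < β) (hcStab : 0 < cStab) (hcApp : 0 < cApp)
    (hcInit : 0 < cInit) (hM : 0 < M) :
    ∃ C : ℝ, 0 < C ∧
      ∀ (s : Fin N → ℝ) (lam : ℝ), (∀ i, 0 < s i ∧ s i ≤ sMax) → 0 < lam → m.μ ≤ cLam * lam →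
      ∀ (f : ℝ → Fin d → MPET.L2 m.Ω) (g : ℝ → Fin N → MPET.L2 m.Ω),
        ContinuousOn f (Set.Icc 0 T) → ContinuousOn g (Set.Icc 0 T) →
      ∀ (u0 : Fin d → MPET.H1 m.Ω) (pt0 : MPET.L2 m.Ω) (p0 : Fin N → MPET.H1 m.Ω),
        MPET.IsCompatible m lam (f 0) u0 pt0 p0 →
      ∀ (u : ℝ → Fin d → MPET.H1 m.Ω) (pt : ℝ → MPET.L2 m.Ω) (p : ℝ → Fin N → MPET.H1 m.Ω),
        MPET.IsSolution m s lam T f g u0 pt0 p0 u pt p →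
        MPET.IsRegular ku kp T M u pt p →
      ∀ (h Δt : ℝ), 0 < h → 0 < Δt → Δt ≤ T →
      ∀ D : MPET.Discretization m, D.Admissible ku kp β cStab cApp h →
      ∀ P0 P1 X0h X1h : MPET.State m,
        D.IsProjection lam (MPET.stateAt u pt p 0) P0 →
        D.IsProjection lam (MPET.stateAt u pt p Δt) P1 →
        D.IsInitial ku cInit h (MPET.stateAt u pt p 0) P0 X0h →
        D.IsMonolithicStep s lam Δt (f Δt) (g 0) (g Δt) X0h X1h →
      -- `P0 - X0h` and `P1 - X1h` are the discrete errors at the times `0` and `Δt`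
      MPET.vNorm m.μ ((P1 - X1h) - (P0 - X0h)).u ^ 2
          + MPET.qtNorm m.μ ((P1 - X1h) - (P0 - X0h)).pt ^ 2
          + MPET.sNorm s m.α lam ((P1 - X1h) - (P0 - X0h)).p ^ 2
          + Δt * D.aNorm (P1 - X1h).p ^ 2
        ≤ C * (Δt ^ 6 + h ^ (2 * kp) + h ^ (2 * ku)) ∧
      MPET.vNorm m.μ (P1 - X1h).u + MPET.qtNorm m.μ (P1 - X1h).pt
          + MPET.sNorm s m.α lam (P1 - X1h).p
        ≤ C * (Δt ^ 3 + h ^ kp + h ^ ku) := by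
  have hμ := hm.μ_pos
  have hσ : 0 < Real.sqrt (2 * m.μ) := Real.sqrt_pos.2 (by positivity)
  set σ := Real.sqrt (2 * m.μ) with hσdef
  obtain ⟨K, K0, hK, hK0, H⟩ := MPET.exists_error_bounds (m := m) hm T ku kp hsMax hcLam hβ hcStab
    hcApp hcInit hM
  -- The four terms of the first estimate added up, where `(a + b)² ≤ 2a² + 2b²` separates new from
  -- old errors.
  set K1 := 4 * K + 4 * K0 ^ 2 + 2 * (σ⁻¹ ^ 2 * K) with hK1
  have hK1' : 0 < K1 := by positivity
  refine ⟨3 * K1 + (2 + σ⁻¹) * Real.sqrt K, by positivity, ?_⟩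
  intro s lam hs hlam hcl f g _ hg u0 pt0 p0 _ u pt p hsol hreg h Δt hh hτ hτT D hD P0 P1 X0h X1h
    hP0 hP1 hini hX
  have E := H s lam hs hlam hcl f g hg u0 pt0 p0 u pt p hsol hreg h Δt hh hτ hτT D hD P0 P1 X0h X1h
    hP0 hP1 hini hX
  have hη0 : 0 ≤ Δt ^ 3 + h ^ kp + h ^ ku := by positivity
  have hη2 : (Δt ^ 3 + h ^ kp + h ^ ku) ^ 2 ≤ 3 * (Δt ^ 6 + h ^ (2 * kp) + h ^ (2 * ku)) := by
    have e1 : Δt ^ 6 = (Δt ^ 3) ^ 2 := by ring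
    rw [e1, mul_comm 2 kp, mul_comm 2 ku, pow_mul, pow_mul]
    nlinarith [sq_nonneg (Δt ^ 3 - h ^ kp), sq_nonneg (Δt ^ 3 - h ^ ku),
      sq_nonneg (h ^ kp - h ^ ku)]
  set η := Δt ^ 3 + h ^ kp + h ^ ku with hη
  have hsq : ∀ a b c : ℝ, 0 ≤ a → a ≤ b + c → a ^ 2 ≤ 2 * b ^ 2 + 2 * c ^ 2 := by
    intro a b c ha habc
    have := pow_le_pow_left₀ ha habc 2
    nlinarith [sq_nonneg (b - c)]
  have hqn : ∀ q : MPET.L2 m.Ω, 0 ≤ MPET.qtNorm m.μ q := fun q => Real.sqrt_nonneg _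
  have ept : MPET.qtNorm m.μ (P1.pt - X1h.pt) ^ 2 ≤ σ⁻¹ ^ 2 * K * η ^ 2 := by
    rw [MPET.qtNorm_eq, mul_pow, mul_assoc]
    exact mul_le_mul_of_nonneg_left E.pt_new (by positivity)
  have hR : 0 ≤ Real.sqrt K * η := by positivity
  have hsqrt : ∀ a : ℝ, a ^ 2 ≤ K * η ^ 2 → a ≤ Real.sqrt K * η := by
    intro a ha
    refine abs_le_of_sq_le_sq' ?_ hR |>.2
    rwa [mul_pow, Real.sq_sqrt hK.le]
  constructor
  · have f1 : MPET.vNorm m.μ ((P1 - X1h) - (P0 - X0h)).u ^ 2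
        ≤ 2 * (K * η ^ 2) + 2 * (K0 * η) ^ 2 := by
      have e1 : MPET.vNorm m.μ ((P1 - X1h) - (P0 - X0h)).u
          ≤ MPET.vNorm m.μ (P1.u - X1h.u) + MPET.vNorm m.μ (P0.u - X0h.u) :=
        MPET.vNorm_sub_le hμ.le _ _
      have e2 := hsq _ _ _ (MPET.vNorm_nonneg _ _) e1
      have e3 := pow_le_pow_left₀ (MPET.vNorm_nonneg _ _) E.u_old 2
      linarith [E.u_new]
    have f2 : MPET.qtNorm m.μ ((P1 - X1h) - (P0 - X0h)).pt ^ 2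
        ≤ 2 * (σ⁻¹ ^ 2 * K * η ^ 2) + 2 * (K0 * η) ^ 2 := by
      have e1 : MPET.qtNorm m.μ ((P1 - X1h) - (P0 - X0h)).pt
          ≤ MPET.qtNorm m.μ (P1.pt - X1h.pt) + MPET.qtNorm m.μ (P0.pt - X0h.pt) := by
        have e0 : ((P1 - X1h) - (P0 - X0h)).pt = (P1.pt - X1h.pt) - (P0.pt - X0h.pt) := rfl
        rw [e0, MPET.qtNorm_eq, MPET.qtNorm_eq, MPET.qtNorm_eq, ← mul_add]
        exact mul_le_mul_of_nonneg_left (norm_sub_le _ _) (by positivity)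
      have e2 := hsq _ _ _ (hqn _) e1
      have e3 := pow_le_pow_left₀ (hqn _) E.pt_old 2
      linarith
    have f3 : MPET.sNorm s m.α lam ((P1 - X1h) - (P0 - X0h)).p ^ 2 ≤ K * η ^ 2 := by
      have e0 : ((P1 - X1h) - (P0 - X0h)).p = (P1.p - X1h.p) - (P0.p - X0h.p) := rfl
      -- The network pressures start without discrete error, so the increment is the new error.
      rw [e0, hini.p_eq, sub_self, sub_zero]
      exact E.p_new
    have f4 : Δt * D.aNorm (P1 - X1h).p ^ 2 ≤ K * η ^ 2 := E.p_energy
    have g1 : K1 * η ^ 2 ≤ K1 * (3 * (Δt ^ 6 + h ^ (2 * kp) + h ^ (2 * ku))) :=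
      mul_le_mul_of_nonneg_left hη2 hK1'.le
    have g2 : 0 ≤ (2 + σ⁻¹) * Real.sqrt K * (Δt ^ 6 + h ^ (2 * kp) + h ^ (2 * ku)) := by
      positivity
    have g3 : K1 * η ^ 2 = 4 * (K * η ^ 2) + 4 * (K0 * η) ^ 2 + 2 * (σ⁻¹ ^ 2 * K * η ^ 2) := by
      rw [hK1]
      ring
    linarith
  · have f1 : MPET.vNorm m.μ (P1 - X1h).u ≤ Real.sqrt K * η := hsqrt _ E.u_new
    have f2 : MPET.qtNorm m.μ (P1 - X1h).pt ≤ σ⁻¹ * (Real.sqrt K * η) := by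
      have e0 : (P1 - X1h).pt = P1.pt - X1h.pt := rfl
      rw [e0, MPET.qtNorm_eq]
      exact mul_le_mul_of_nonneg_left (hsqrt _ E.pt_new) (by positivity)
    have f3 : MPET.sNorm s m.α lam (P1 - X1h).p ≤ Real.sqrt K * η := hsqrt _ E.p_new
    have g1 : 0 ≤ 3 * K1 * η := by positivity
    linarith
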